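/- Let $q$ be an odd prime power and let $C/\mathbb{F}_q$ be a hyperelliptic curve of genus $g$, that is, a smooth projective absolutely irreducible curve of genus $g\ge 2$ with a map of degree $2$ to $\mathbb{P}^1$ over $\mathbb{F}_q$. The rational Weierstrass points of such a curve are the rational points at which its (essentially unique) map of degree $2$ to $\mathbb{P}^1$ ramifies. A double cover of $C$ is a curve $D/\mathbb{F}_q$ with an $\mathbb{F}_q$-morphism $D\to C$ of degree $2$. (1) If $C$ has exactly two rational Weierstrass points, then there is a hyperelliptic curve $D/\mathbb{F}_q$ of genus $2g$ that is a double cover of $C$, that has exactly two rational Weierstrass points, and that satisfies $\#D(\mathbb{F}_q)\ge \#C(\mathbb{F}_q)$. (2) If $C$ has fewer than $q$ rational Weierstrass points, then there is a hyperelliptic curve $D/\mathbb{F}_q$ of genus $2g+1$ that is a double cover of $C$ and that satisfies $\#D(\mathbb{F}_q)\ge \#C(\mathbb{F}_q)$. If $C$ has exactly two rational Weierstrass points, then $D$ can be chosen to have exactly two rational Weierstrass points as well. -/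

import Mathlib

universe u v

open scoped IntermediateField

/-- A smooth projective absolutely irreducible curve over a perfect field `k` (here: a finite field),
presented as the abstract nonsingular curve of its function field `K`: a field `K/k` that is finite
over `k(x)` for some transcendental `x`, and in which `k` is algebraically closed (for perfect `k`
this is absolute irreducibility).  Its closed points are the places of `K/k`, and nonconstant
morphisms `D ⟶ C` are the `k`-embeddings of the function field of `C` into that of `D`. -/
structure SmoothProjCurve (k : Type u) [Field k] where
  /-- The function field of the curve. -/
  K : Type v
  [field : Field K]
  [algebra : Algebra k K]
  exists_finite : ∃ x : K, Transcendental k x ∧ FiniteDimensional k⟮x⟯ K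
  constants : ∀ a : K, IsAlgebraic k a → a ∈ (algebraMap k K).range

namespace SmoothProjCurve

attribute [instance] SmoothProjCurve.field SmoothProjCurve.algebra

variable {k : Type u} [Field k]

/-- The closed points of the curve, each given by its local ring: the valuation rings of the
function field, other than the field itself, that contain `k`. -/
def points (C : SmoothProjCurve.{u, v} k) : Set (ValuationSubring C.K) :=
  {P | P ≠ ⊤ ∧ ∀ c : k, algebraMap k C.K c ∈ P}

/-- The `k`-rational points, i.e. the closed points of degree one: every element of the local
ring is congruent to a constant modulo the maximal ideal, so the residue field is `k`. -/
def rationalPoints (C : SmoothProjCurve.{u, v} k) : Set (ValuationSubring C.K) :=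
  {P | P ∈ C.points ∧ ∀ a ∈ P, ∃ c : k, P.valuation (a - algebraMap k C.K c) < 1}

/-- The global regular differentials `H⁰(C, Ω)`: the differentials of the function field that at
every closed point `P` lie in the module of differentials of the local ring at `P`, that is, are
sums of terms `a db` with `a` and `b` regular at `P`. -/
noncomputable def regularDifferentials (C : SmoothProjCurve.{u, v} k) :
    Submodule k (KaehlerDifferential k C.K) :=
  ⨅ P ∈ C.points,
    Submodule.span k {ω | ∃ a ∈ P, ∃ b ∈ P, ω = a • KaehlerDifferential.D k C.K b}

/-- The genus: the dimension of the space of global regular differentials. -/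
noncomputable def genus (C : SmoothProjCurve.{u, v} k) : ℕ :=
  Module.finrank k C.regularDifferentials

/-- `x`, viewed as a morphism from the curve to the projective line, has degree two. -/
def IsDegreeTwoMap (C : SmoothProjCurve.{u, v} k) (x : C.K) : Prop :=
  Module.finrank k⟮x⟯ C.K = 2

/-- A hyperelliptic curve: genus at least two, and a map of degree two to the projective line. -/
def IsHyperelliptic (C : SmoothProjCurve.{u, v} k) : Prop :=
  2 ≤ C.genus ∧ ∃ x : C.K, C.IsDegreeTwoMap x

/-- The point `P` is ramified over the subfield `F` of the function field (that is, in the map from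
the curve to the curve with function field `F`): functions in `F` that vanish at `P` vanish there
to order at least two. -/
def IsRamifiedAt (C : SmoothProjCurve.{u, v} k) (F : IntermediateField k C.K)
    (P : ValuationSubring C.K) : Prop :=
  ∀ z : P, (z : C.K) ∈ F → z ∈ IsLocalRing.maximalIdeal P → z ∈ IsLocalRing.maximalIdeal P ^ 2

/-- The rational Weierstrass points of a hyperelliptic curve in odd characteristic: the rational
points at which the canonical double cover of the projective line ramifies.  (For genus at least two
the subfield `k(x)` of index two does not depend on the choice of `x`.) -/
def rationalWeierstrassPoints (C : SmoothProjCurve.{u, v} k) : Set (ValuationSubring C.K) :=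
  {P | P ∈ C.rationalPoints ∧ ∃ x : C.K, C.IsDegreeTwoMap x ∧ C.IsRamifiedAt k⟮x⟯ P}

/-- `D` is a double cover of `C` over `k`: there is a `k`-morphism `D ⟶ C` of degree two. -/
def IsDoubleCoverOf (D C : SmoothProjCurve.{u, v} k) : Prop :=
  ∃ φ : C.K →ₐ[k] D.K, Module.finrank φ.fieldRange D.K = 2

end SmoothProjCurve

/-! Completing the square presents `C` as y² = f(x) with f separable of degree 2g + 1 or 2g + 2; the
rational branch points are the roots of f in k, and ∞ when the degree is odd. If f(a) ≠ 0 and b ≠ 0,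
adjoining a square root z of (x − a)/b gives the double cover w² = f(a + bz²). Its right-hand side
is separable of degree 2 deg f, so its genus is deg f − 1: 2g if ∞ is a branch point, 2g + 1 if not
(`exists_doubleCover`). With χ the quadratic character, it has Σ_x (1 + χ(b)χ(x − a))(1 + χ(f(x)))
affine rational points (`pointCount_comp`).

Genus 2g + 1: fewer than q of the q + 1 rational points of the line are branch points, so two others
can be moved to 0 and ∞. For a = 0 the covers with b = 1 and with b a nonsquare have 2·#C points
together, so one of them has enough (`pointCount_twist_add`). If there are exactly two rational
branch points, they are put at s and ns with n a nonsquare. Then exactly one of s/b, ns/b is a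
square, which leaves two rational Weierstrass points on the cover.

Genus 2g: the two rational branch points are put at ∞ and 0, and b = −a, so that 0 splits and
provides both Weierstrass points. Averaging over a ≠ 0, with a parity remark, yields a suitable a
(`exists_pointCount_le`).

The remaining work connects the abstract definitions with the equation. The regular differentials
are A(x) dx/y with deg A < g (`forall_mem_local_iff`). This gives the genus, and for g ≥ 2 it shows
that k(x) is intrinsic, being generated by quotients of regular differentials. Rational points are
the solutions of the equation in two charts (`encard_eq`), ramified exactly where the second
coordinate is 0 (`ramified_iff`). -/

open Polynomial

/-- The field `K` is presented as the function field `k(x, y)` of the curve `y ^ 2 = f(x)` with `f`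
separable of degree `2 * g + 1` or `2 * g + 2`. -/
structure IsHyperellipticModel {k K : Type*} [Field k] [Field K] [Algebra k K]
    (g : ℕ) (f : k[X]) (x y : K) : Prop where
  two_ne : (2 : k) ≠ 0
  transcendental : Transcendental k x
  sq_eq : y ^ 2 = aeval x f
  adjoin_eq_top : k⟮x, y⟯ = ⊤
  separable : f.Separable
  le_natDegree : 2 * g + 1 ≤ f.natDegree
  natDegree_le : f.natDegree ≤ 2 * g + 2

/-! ### Fractions in lowest terms -/

theorem Polynomial.exists_dvd_three {k : Type*} [Field k] (A B C : k[X]) (hC : C ≠ 0) :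
    ∃ D A' B' C' : k[X], D ≠ 0 ∧ A = D * A' ∧ B = D * B' ∧ C = D * C' ∧
      ∃ a b c, a * A' + b * B' + c * C' = 1 := by
  classical
  set D := EuclideanDomain.gcd (EuclideanDomain.gcd A B) C with hD
  have h1 : D ∣ EuclideanDomain.gcd A B := EuclideanDomain.gcd_dvd_left _ _
  have h2 : D ∣ C := EuclideanDomain.gcd_dvd_right _ _
  obtain ⟨A', hA'⟩ := h1.trans (EuclideanDomain.gcd_dvd_left A B)
  obtain ⟨B', hB'⟩ := h1.trans (EuclideanDomain.gcd_dvd_right A B)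
  obtain ⟨C', hC'⟩ := h2
  have hD0 : D ≠ 0 := by
    rintro h
    rw [h, zero_mul] at hC'
    exact hC hC'
  refine ⟨D, A', B', C', hD0, hA', hB', hC', ?_⟩
  have e1 := EuclideanDomain.gcd_eq_gcd_ab (EuclideanDomain.gcd A B) C
  have e2 := EuclideanDomain.gcd_eq_gcd_ab A B
  rw [← hD] at e1
  set p := EuclideanDomain.gcdA (EuclideanDomain.gcd A B) C
  set r := EuclideanDomain.gcdB (EuclideanDomain.gcd A B) C
  set s := EuclideanDomain.gcdA A B
  set t := EuclideanDomain.gcdB A B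
  refine ⟨s * p, t * p, r, mul_left_cancel₀ hD0 ?_⟩
  linear_combination (s * p) * (-hA') + (t * p) * (-hB') + r * (-hC') - e1 - p * e2

theorem Polynomial.exists_dvd_two {k : Type*} [Field k] (A C : k[X]) (hC : C ≠ 0) :
    ∃ D A' C' : k[X], D ≠ 0 ∧ A = D * A' ∧ C = D * C' ∧ IsCoprime A' C' := by
  obtain ⟨D, A', B', C', hD, hA, hB, hC, a, b, c, h⟩ := exists_dvd_three A 0 C hC
  have hB' : B' = 0 := by simpa [hD] using hB.symm
  subst hB'
  exact ⟨D, A', C', hD, hA, hC, a, c, by simpa using h⟩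

theorem exists_coprime_of_mem_adjoin {k K : Type*} [Field k] [Field K] [Algebra k K] {x : K}
    (hx : Transcendental k x) {z : K} (hz : z ∈ k⟮x⟯) :
    ∃ U V : k[X], IsCoprime U V ∧ V ≠ 0 ∧ z * aeval x V = aeval x U := by
  obtain ⟨r, s, rfl⟩ := (IntermediateField.mem_adjoin_simple_iff k z).1 hz
  by_cases hs : s = 0
  · exact ⟨0, 1, isCoprime_one_right, one_ne_zero, by simp [hs]⟩
  obtain ⟨D, U, V, hD, rfl, rfl, hUV⟩ := exists_dvd_two r s hs
  refine ⟨U, V, hUV, right_ne_zero_of_mul hs, ?_⟩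
  have h1 : aeval x D ≠ 0 := fun e => hD (transcendental_iff.1 hx _ e)
  have h2 : aeval x V ≠ 0 := fun e => right_ne_zero_of_mul hs (transcendental_iff.1 hx _ e)
  simp only [map_mul]
  field_simp

theorem aeval_mem_adjoin {k K : Type*} [Field k] [Field K] [Algebra k K] (x : K) (A : k[X]) :
    aeval x A ∈ k⟮x⟯ :=
  (IntermediateField.mem_adjoin_simple_iff k _).2 ⟨A, 1, by simp⟩

/-! ### The function field of y² = f(x) -/

namespace IsHyperellipticModel

variable {k K : Type*} [Field k] [Field K] [Algebra k K] {g : ℕ} {f : k[X]} {x y : K}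

theorem aeval_ne_zero (h : IsHyperellipticModel g f x y) {A : k[X]} (hA : A ≠ 0) :
    aeval x A ≠ 0 :=
  fun e => hA (transcendental_iff.1 h.transcendental _ e)

theorem aeval_injective (h : IsHyperellipticModel g f x y) {A B : k[X]}
    (e : aeval x A = aeval x B) : A = B := by
  rw [← sub_eq_zero, ← map_sub] at e
  exact sub_eq_zero.1 (transcendental_iff.1 h.transcendental _ e)

theorem ne_zero (h : IsHyperellipticModel g f x y) : f ≠ 0 := h.separable.ne_zero

theorem not_isUnit (h : IsHyperellipticModel g f x y) : ¬ IsUnit f := fun hu => by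
  have := natDegree_eq_zero_of_isUnit hu
  have := h.le_natDegree
  omega

theorem y_ne_zero (h : IsHyperellipticModel g f x y) : y ≠ 0 := by
  rintro rfl
  exact h.aeval_ne_zero h.ne_zero (by rw [← h.sq_eq]; simp)

theorem two_ne' (h : IsHyperellipticModel g f x y) : (2 : K) ≠ 0 := by
  have := (map_ne_zero (algebraMap k K)).2 h.two_ne
  rwa [map_ofNat] at this

/-- The relation `A ^ 2 = f * B ^ 2` has only the trivial solution. -/
theorem eq_zero_of_sq_eq (h : IsHyperellipticModel g f x y) {A B : k[X]}
    (e : A ^ 2 = f * B ^ 2) : B = 0 := by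
  by_contra hB
  have h1 : B ^ 2 ∣ A ^ 2 := ⟨f, by rw [e]; ring⟩
  obtain ⟨E, rfl⟩ := (IsIntegrallyClosed.pow_dvd_pow_iff two_ne_zero).1 h1
  have h2 : E * E = f := by
    apply mul_left_cancel₀ (pow_ne_zero 2 hB)
    linear_combination e
  have h3 := h.separable.squarefree E ⟨1, by rw [h2, mul_one]⟩
  exact h.not_isUnit (h2 ▸ h3.mul h3)

theorem y_notMem (h : IsHyperellipticModel g f x y) : y ∉ k⟮x⟯ := by
  intro hy
  obtain ⟨U, V, -, hV, e⟩ := exists_coprime_of_mem_adjoin h.transcendental hy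
  refine hV (h.eq_zero_of_sq_eq (A := U) (h.aeval_injective ?_))
  simp only [map_mul, map_pow, ← e, ← h.sq_eq]
  ring

theorem eq_zero_of_add_mul (h : IsHyperellipticModel g f x y) {r s : K} (hr : r ∈ k⟮x⟯)
    (hs : s ∈ k⟮x⟯) (e : r + s * y = 0) : r = 0 ∧ s = 0 := by
  have hs0 : s = 0 := by
    by_contra hs0
    apply h.y_notMem
    have : y = -r / s := by field_simp; linear_combination e
    rw [this]
    exact div_mem (neg_mem hr) hs
  subst hs0
  simpa using e

theorem poly_eq_zero (h : IsHyperellipticModel g f x y) {A B : k[X]}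
    (e : aeval x A + aeval x B * y = 0) : A = 0 ∧ B = 0 := by
  obtain ⟨h1, h2⟩ := h.eq_zero_of_add_mul (aeval_mem_adjoin _ _) (aeval_mem_adjoin _ _) e
  exact ⟨transcendental_iff.1 h.transcendental _ h1, transcendental_iff.1 h.transcendental _ h2⟩

theorem exists_add_mul (h : IsHyperellipticModel g f x y) (b : K) :
    ∃ r ∈ k⟮x⟯, ∃ s ∈ k⟮x⟯, b = r + s * y := by
  have hb : b ∈ k⟮x, y⟯ := by rw [h.adjoin_eq_top]; trivial
  have hf : y ^ 2 ∈ k⟮x⟯ := by rw [h.sq_eq]; exact aeval_mem_adjoin _ _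
  induction hb using IntermediateField.adjoin_induction with
  | mem z hz =>
    rcases hz with rfl | rfl
    · exact ⟨z, IntermediateField.mem_adjoin_simple_self _ _, 0, zero_mem _, by simp⟩
    · exact ⟨0, zero_mem _, 1, one_mem _, by simp⟩
  | algebraMap c => exact ⟨_, IntermediateField.algebraMap_mem _ c, 0, zero_mem _, by simp⟩
  | add a b _ _ ha hb =>
    obtain ⟨r, hr, s, hs, rfl⟩ := ha
    obtain ⟨r', hr', s', hs', rfl⟩ := hb
    exact ⟨_, add_mem hr hr', _, add_mem hs hs', by ring⟩
  | mul a b _ _ ha hb =>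
    obtain ⟨r, hr, s, hs, rfl⟩ := ha
    obtain ⟨r', hr', s', hs', rfl⟩ := hb
    exact ⟨r * r' + s * s' * y ^ 2, add_mem (mul_mem hr hr') (mul_mem (mul_mem hs hs') hf),
      r * s' + s * r', add_mem (mul_mem hr hs') (mul_mem hs hr'), by ring⟩
  | inv a _ ha =>
    obtain ⟨r, hr, s, hs, rfl⟩ := ha
    have hN : r ^ 2 - s ^ 2 * y ^ 2 ∈ k⟮x⟯ :=
      sub_mem (pow_mem hr 2) (mul_mem (pow_mem hs 2) hf)
    by_cases h0 : r + s * y = 0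
    · exact ⟨0, zero_mem _, 0, zero_mem _, by simp [h0]⟩
    by_cases h1 : r - s * y = 0
    · have := h.eq_zero_of_add_mul hr (neg_mem hs) (by linear_combination h1)
      exact absurd (by simp_all) h0
    · refine ⟨r / (r ^ 2 - s ^ 2 * y ^ 2), div_mem hr hN, -s / (r ^ 2 - s ^ 2 * y ^ 2),
        div_mem (neg_mem hs) hN, ?_⟩
      have : r ^ 2 - s ^ 2 * y ^ 2 = (r + s * y) * (r - s * y) := by ring
      rw [this]
      field_simp
      ring

/-- The Bézout relation says that A, B, C have no common zero. The local arguments on the affine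
chart rest on this normal form. -/
theorem exists_fraction (h : IsHyperellipticModel g f x y) (b : K) :
    ∃ A B C : k[X], C ≠ 0 ∧ b * aeval x C = aeval x A + aeval x B * y ∧
      ∃ p q r, p * A + q * B + r * C = 1 := by
  obtain ⟨r, hr, s, hs, rfl⟩ := h.exists_add_mul b
  obtain ⟨U, V, -, hV, e⟩ := exists_coprime_of_mem_adjoin h.transcendental hr
  obtain ⟨U', V', -, hV', e'⟩ := exists_coprime_of_mem_adjoin h.transcendental hs
  obtain ⟨D, A, B, C, hD, hA, hB, hC, hc⟩ :=
    exists_dvd_three (U * V') (U' * V) (V * V') (mul_ne_zero hV hV')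
  refine ⟨A, B, C, fun h0 => mul_ne_zero hV hV' (by rw [hC, h0, mul_zero]), ?_, hc⟩
  apply mul_left_cancel₀ (h.aeval_ne_zero hD)
  have hA' := congrArg (aeval x) hA
  have hB' := congrArg (aeval x) hB
  have hC' := congrArg (aeval x) hC
  simp only [map_mul] at hA' hB' hC'
  linear_combination (-(r + s * y)) * hC' + hA' + y * hB' + aeval x V' * e + aeval x V * y * e'

theorem finrank_eq_two (h : IsHyperellipticModel g f x y) : Module.finrank k⟮x⟯ K = 2 := by
  have hli : LinearIndependent k⟮x⟯ ![(1 : K), y] := by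
    rw [LinearIndependent.pair_iff]
    intro s t e
    obtain ⟨h1, h2⟩ := h.eq_zero_of_add_mul s.2 t.2
      (by simpa [IntermediateField.smul_def] using e)
    exact ⟨Subtype.ext h1, Subtype.ext h2⟩
  have hsp : ⊤ ≤ Submodule.span k⟮x⟯ (Set.range ![(1 : K), y]) := by
    rintro b -
    obtain ⟨r, hr, s, hs, rfl⟩ := h.exists_add_mul b
    simp only [Matrix.range_cons, Matrix.range_empty, Set.union_empty, Set.singleton_union]
    rw [Submodule.mem_span_pair]
    exact ⟨⟨r, hr⟩, ⟨s, hs⟩, by simp [IntermediateField.smul_def]⟩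
  simpa using Module.finrank_eq_card_basis (Module.Basis.mk hli hsp)

theorem finiteDimensional (h : IsHyperellipticModel g f x y) : FiniteDimensional k⟮x⟯ K :=
  FiniteDimensional.of_finrank_pos (by rw [h.finrank_eq_two]; norm_num)

theorem exists_conj (h : IsHyperellipticModel g f x y) :
    ∃ σ : K ≃ₐ[k] K, σ x = x ∧ σ y = -y := by
  have := h.finiteDimensional
  have : Algebra.IsQuadraticExtension k⟮x⟯ K := ⟨h.finrank_eq_two⟩
  have hroot : aeval (-y) (minpoly k⟮x⟯ y) = 0 := by
    set F : k⟮x⟯ := ⟨aeval x f, aeval_mem_adjoin _ _⟩ with hF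
    have hirr : minpoly k⟮x⟯ y = X ^ 2 - C F := by
      symm
      apply minpoly.eq_of_irreducible_of_monic
      · rw [X_pow_sub_C_irreducible_iff_of_prime Nat.prime_two]
        intro b hb
        have hb' : (b : K) ^ 2 = y ^ 2 := by
          rw [h.sq_eq]
          exact congrArg Subtype.val hb
        rcases sq_eq_sq_iff_eq_or_eq_neg.1 hb' with e | e
        · exact h.y_notMem (e ▸ b.2)
        · exact h.y_notMem (by rw [← neg_neg y, ← e]; exact neg_mem b.2)
      · simp [h.sq_eq, hF, IntermediateField.algebraMap_apply]
      · exact monic_X_pow_sub_C _ two_ne_zero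
    simp [hirr, h.sq_eq, hF, IntermediateField.algebraMap_apply]
  obtain ⟨σ, hσ⟩ := minpoly.exists_algEquiv_of_root' (K := k⟮x⟯) (L := K) (x := -y) (y := y)
    (Algebra.IsAlgebraic.isAlgebraic y) hroot
  refine ⟨σ.restrictScalars k, ?_, hσ⟩
  exact σ.commutes ⟨x, IntermediateField.mem_adjoin_simple_self k x⟩

/-- A nonconstant element of k(x) is transcendental. If r + sy is algebraic, so is its conjugate,
hence r and sy are algebraic. Then s²f is a constant, which forces s = 0 because f is squarefree of
positive degree. -/
theorem mem_range_of_isAlgebraic (h : IsHyperellipticModel g f x y) {a : K}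
    (ha : IsAlgebraic k a) : a ∈ (algebraMap k K).range := by
  have key : ∀ z ∈ k⟮x⟯, IsAlgebraic k z → z ∈ (algebraMap k K).range := by
    intro z hz hza
    obtain ⟨U, V, hUV, hV, e⟩ := exists_coprime_of_mem_adjoin h.transcendental hz
    obtain ⟨P, hP, hP0⟩ := hza
    have hVx := h.aeval_ne_zero hV
    by_contra hz
    by_cases hUz : U = 0
    · subst hUz
      have : z = 0 := by simpa [hVx] using e
      exact hz (this ▸ zero_mem _)
    by_cases hVd : V.natDegree = 0 ∧ U.natDegree = 0
    · obtain ⟨c, rfl⟩ := natDegree_eq_zero.1 hVd.1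
      obtain ⟨d, rfl⟩ := natDegree_eq_zero.1 hVd.2
      simp only [aeval_C] at e hVx
      exact hz ⟨d / c, by rw [map_div₀, ← e]; field_simp⟩
    -- With z = U(x)/V(x) nonconstant, x is a root of the nonzero polynomial U − zV over k(z), so z
    -- algebraic would make x algebraic.
    · apply h.transcendental
      have hz' : IsAlgebraic k z := ⟨P, hP, hP0⟩
      have : IsIntegral k⟮z⟯ x := by
        rw [← isAlgebraic_iff_isIntegral]
        have hne : U.map (algebraMap k k⟮z⟯) - C (⟨z, IntermediateField.mem_adjoin_simple_self k z⟩ : k⟮z⟯) *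
            V.map (algebraMap k k⟮z⟯) ≠ 0 := by
          intro h0
          apply hz
          by_cases hV' : ∃ n, V.coeff n ≠ 0
          · obtain ⟨n, hn⟩ := hV'
            have := congrArg (fun p => ((p.coeff n : k⟮z⟯) : K)) h0
            simp only [coeff_sub, coeff_map, coeff_C_mul, coeff_zero] at this
            have e2 : algebraMap k K (U.coeff n) - z * algebraMap k K (V.coeff n) = 0 := this
            have hn' : algebraMap k K (V.coeff n) ≠ 0 := by simpa using hn
            exact ⟨U.coeff n / V.coeff n, by
              rw [map_div₀, div_eq_iff hn']; linear_combination e2⟩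
          · push Not at hV'
            exact absurd (Polynomial.ext (by simpa using hV')) hV
        refine ⟨_, hne, ?_⟩
        simp only [map_sub, map_mul, aeval_C, aeval_map_algebraMap]
        rw [← e]
        simp [IntermediateField.algebraMap_apply]
      have hfin : Algebra.IsIntegral k k⟮z⟯ := by
        have := (IntermediateField.isAlgebraic_adjoin_simple hz'.isIntegral)
        infer_instance
      exact (isIntegral_trans (R := k) (A := k⟮z⟯) x this).isAlgebraic
  obtain ⟨σ, hσx, hσy⟩ := h.exists_conj
  have hσ : ∀ z ∈ k⟮x⟯, σ z = z := by
    intro z hz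
    obtain ⟨U, V, -, hV, e⟩ := exists_coprime_of_mem_adjoin h.transcendental hz
    have hVx := h.aeval_ne_zero hV
    have := congrArg σ e
    rw [map_mul, ← aeval_algHom_apply, ← aeval_algHom_apply, hσx, ← e] at this
    exact mul_right_cancel₀ hVx this
  obtain ⟨r, hr, s, hs, rfl⟩ := h.exists_add_mul a
  have h2 := h.two_ne'
  have hconj : IsAlgebraic k (r - s * y) := by
    have := ha.algHom (σ : K →ₐ[k] K)
    simpa [hσ r hr, hσ s hs, hσy, sub_eq_add_neg] using this
  have h2a : IsAlgebraic k (2 : K) := by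
    simpa only [map_ofNat] using isAlgebraic_algebraMap (R := k) (A := K) 2
  have hr' : IsAlgebraic k r := by
    have : r = (r + s * y + (r - s * y)) / 2 := by field_simp; ring
    rw [this, div_eq_mul_inv]
    exact (ha.add hconj).mul h2a.inv
  have hsy : IsAlgebraic k (s * y) := by
    have : s * y = (r + s * y) - r := by ring
    rw [this]
    exact ha.sub hr'
  have hs0 : s = 0 := by
    obtain ⟨c, hc⟩ := key _ (by
      rw [mul_pow, h.sq_eq]
      exact mul_mem (pow_mem hs 2) (aeval_mem_adjoin _ _)) (hsy.pow 2)
    obtain ⟨U, V, hUV, hV, e⟩ := exists_coprime_of_mem_adjoin h.transcendental hs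
    by_contra hs0
    have h3 : f * U ^ 2 = C c * V ^ 2 := by
      apply h.aeval_injective
      simp only [map_mul, map_pow, aeval_C, ← e, ← h.sq_eq, hc]
      ring
    have h4 : V ^ 2 ∣ f := by
      refine (hUV.symm.pow (m := 2) (n := 2)).dvd_of_dvd_mul_right ⟨C c, by rw [h3]; ring⟩
    have hVu : IsUnit V := h.separable.squarefree V (by rwa [← sq])
    have h5 := congrArg natDegree h3
    have hU : U ≠ 0 := by
      rintro rfl
      simp [hs0, h.aeval_ne_zero hV] at e
    rw [natDegree_mul h.ne_zero (pow_ne_zero 2 hU)] at h5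
    have h6 := natDegree_mul_le (p := C c) (q := V ^ 2)
    rw [natDegree_pow, natDegree_eq_zero_of_isUnit hVu, natDegree_C] at h6
    have := h.le_natDegree
    omega
  subst hs0
  simpa using key r hr hr'

end IsHyperellipticModel

/-! ### Changes of coordinate: the chart at infinity and translations -/

theorem Polynomial.aeval_inv_reflect_mul_pow {k K : Type*} [Field k] [Field K] [Algebra k K] {x : K}
    (hx : x ≠ 0) {A : k[X]} {N : ℕ} (hA : A.natDegree ≤ N) :
    aeval x⁻¹ (A.reflect N) * x ^ N = aeval x A := by
  let _ := invertibleOfNonzero hx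
  have := eval₂_reflect_mul_pow (algebraMap k K) x N A hA
  rwa [invOf_eq_inv] at this

theorem Polynomial.natDegree_reflect_le' {k : Type*} [Field k] {A : k[X]} {N : ℕ}
    (hA : A.natDegree ≤ N) : (A.reflect N).natDegree ≤ N :=
  natDegree_reflect_le.trans (by simp [hA])

/-- Reflection is multiplicative, so a square factor p² of the reflection yields a square factor of
f, and the reflection of p is constant. Thus p is a constant times a power of X. A positive power
would kill the coefficients of f in degrees 2g + 2 and 2g + 1, against the lower degree bound. -/
theorem Polynomial.squarefree_reflect {k : Type*} [Field k] {f : k[X]} {g : ℕ}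
    (hf : Squarefree f) (h1 : 2 * g + 1 ≤ f.natDegree) (h2 : f.natDegree ≤ 2 * g + 2) :
    Squarefree (f.reflect (2 * g + 2)) := by
  have hf0 : f ≠ 0 := hf.ne_zero
  rintro p ⟨s, hs⟩
  set F := f.reflect (2 * g + 2) with hF
  have hF0 : F ≠ 0 := by rwa [hF, Ne, reflect_eq_zero_iff]
  have hfF : f = F.reflect (2 * g + 2) := by
    ext n; simp [hF]
  have hp0 : p ≠ 0 := by rintro rfl; simp at hs; exact hF0 hs
  have hs0 : s ≠ 0 := by rintro rfl; simp at hs; exact hF0 hs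
  have hdeg : F.natDegree = p.natDegree + p.natDegree + s.natDegree := by
    rw [hs, natDegree_mul (mul_ne_zero hp0 hp0) hs0, natDegree_mul hp0 hp0]
  have hFd : F.natDegree ≤ 2 * g + 2 := natDegree_reflect_le' h2
  have key : f = p.reflect p.natDegree * p.reflect p.natDegree *
      s.reflect (2 * g + 2 - (p.natDegree + p.natDegree)) := by
    rw [← reflect_mul _ _ le_rfl le_rfl, ← reflect_mul _ _ (by rw [natDegree_mul hp0 hp0]) (by omega),
      ← hs, hfF]
    congr 1
    omega
  have hu := hf _ ⟨_, key⟩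
  have hpd : p.natDegree = 0 := by
    by_contra hd
    have hcoef : ∀ i < p.natDegree, p.coeff i = 0 := by
      intro i hi
      have h3 := natDegree_eq_zero_of_isUnit hu
      have : (p.reflect p.natDegree).coeff (p.natDegree - i) = 0 :=
        coeff_eq_zero_of_natDegree_lt (by omega)
      rw [coeff_reflect, revAt_le (by omega)] at this
      rwa [Nat.sub_sub_self hi.le] at this
    have hX : X ∣ p := X_dvd_iff.2 (hcoef 0 (by omega))
    have hX2 : X ^ 2 ∣ F := by
      rw [sq, hs]
      exact (mul_dvd_mul hX hX).mul_right _
    rw [X_pow_dvd_iff] at hX2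
    have e0 := hX2 0 (by norm_num)
    have e1 := hX2 1 (by norm_num)
    rw [hF, coeff_reflect, revAt_le (by omega)] at e0 e1
    have hlc : f.coeff f.natDegree ≠ 0 := by
      rw [coeff_natDegree]; exact leadingCoeff_ne_zero.2 hf0
    rcases (by omega : f.natDegree = 2 * g + 2 - 0 ∨ f.natDegree = 2 * g + 2 - 1) with h | h
    · rw [h] at hlc; exact hlc e0
    · rw [h] at hlc; exact hlc e1
  obtain ⟨c, rfl⟩ := natDegree_eq_zero.1 hpd
  exact isUnit_C.2 (isUnit_iff_ne_zero.2 (by simpa using hp0))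

theorem Polynomial.Separable.comp_X_add_C {k : Type*} [Field k] {f : k[X]} (hf : f.Separable)
    (c : k) : (f.comp (X + C c)).Separable := by
  obtain ⟨a, b, e⟩ := hf
  refine ⟨a.comp (X + C c), b.comp (X + C c), ?_⟩
  have := congrArg (fun p => p.comp (X + C c)) e
  simpa [derivative_comp] using this

namespace IsHyperellipticModel

variable {k K : Type*} [Field k] [Field K] [Algebra k K] {g : ℕ} {f : k[X]} {x y : K}

theorem x_ne_zero (h : IsHyperellipticModel g f x y) : x ≠ 0 := by
  simpa using h.aeval_ne_zero (A := X) X_ne_zero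

theorem inv [PerfectField k] (h : IsHyperellipticModel g f x y) :
    IsHyperellipticModel g (f.reflect (2 * g + 2)) x⁻¹ (y * x⁻¹ ^ (g + 1)) where
  two_ne := h.two_ne
  transcendental := fun ha => h.transcendental (by simpa using ha.inv)
  sq_eq := by
    have hx := h.x_ne_zero
    have := aeval_inv_reflect_mul_pow hx h.natDegree_le
    rw [← mul_left_inj' (pow_ne_zero (2 * g + 2) hx), this, ← h.sq_eq]
    rw [mul_pow, ← pow_mul, mul_assoc, show (g + 1) * 2 = 2 * g + 2 by ring, ← mul_pow,
      inv_mul_cancel₀ hx, one_pow, mul_one]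
  adjoin_eq_top := by
    rw [eq_top_iff, ← h.adjoin_eq_top, IntermediateField.adjoin_le_iff]
    have hx : x ∈ k⟮x⁻¹, y * x⁻¹ ^ (g + 1)⟯ := by
      have := inv_mem (IntermediateField.subset_adjoin k {x⁻¹, y * x⁻¹ ^ (g + 1)} (Or.inl rfl))
      simpa using this
    rintro z (rfl | rfl)
    · exact hx
    · have := mul_mem (IntermediateField.subset_adjoin k {x⁻¹, z * x⁻¹ ^ (g + 1)} (Or.inr rfl))
        (pow_mem hx (g + 1))
      have hx0 := h.x_ne_zero
      rwa [mul_assoc, ← mul_pow, inv_mul_cancel₀ hx0, one_pow, mul_one] at this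
  separable := by
    rw [PerfectField.separable_iff_squarefree]
    exact squarefree_reflect h.separable.squarefree h.le_natDegree h.natDegree_le
  natDegree_le := natDegree_reflect_le' h.natDegree_le
  le_natDegree := by
    by_contra! hlt
    have h0 : (f.reflect (2 * g + 2)).coeff (2 * g + 2) = 0 :=
      coeff_eq_zero_of_natDegree_lt (by omega)
    have h1 : (f.reflect (2 * g + 2)).coeff (2 * g + 1) = 0 :=
      coeff_eq_zero_of_natDegree_lt (by omega)
    rw [coeff_reflect, revAt_le (by omega), Nat.sub_self] at h0
    rw [coeff_reflect, revAt_le (by omega), show 2 * g + 2 - (2 * g + 1) = 1 by omega] at h1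
    -- A drop of two or more in the degree of the reflection means that the two lowest coefficients
    -- of f vanish.
    have hX : X ^ 2 ∣ f := by
      rw [X_pow_dvd_iff]
      intro d hd
      interval_cases d <;> assumption
    have := natDegree_eq_zero_of_isUnit (h.separable.squarefree X (by rwa [← sq]))
    simp at this

theorem translate (h : IsHyperellipticModel g f x y) (c : k) :
    IsHyperellipticModel g (f.comp (X + C c)) (x - algebraMap k K c) y where
  two_ne := h.two_ne
  transcendental := fun ha => h.transcendental (by
    simpa using ha.add (isAlgebraic_algebraMap (R := k) (A := K) c))
  sq_eq := by simp [aeval_comp, h.sq_eq]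
  adjoin_eq_top := by
    rw [eq_top_iff, ← h.adjoin_eq_top, IntermediateField.adjoin_le_iff]
    rintro z (rfl | rfl)
    · have := add_mem (IntermediateField.subset_adjoin k {z - algebraMap k K c, y} (Or.inl rfl))
        (IntermediateField.algebraMap_mem _ c)
      simpa using this
    · exact IntermediateField.subset_adjoin _ _ (Or.inr rfl)
  separable := h.separable.comp_X_add_C c
  natDegree_le := by simpa [natDegree_comp] using h.natDegree_le
  le_natDegree := by simpa [natDegree_comp] using h.le_natDegree

theorem exists_conj' (h : IsHyperellipticModel g f x y) :
    ∃ σ : K ≃ₐ[k] K, (∀ A : k[X], σ (aeval x A) = aeval x A) ∧ σ y = -y := by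
  obtain ⟨σ, hx, hy⟩ := h.exists_conj
  exact ⟨σ, fun A => by rw [← aeval_algHom_apply, hx], hy⟩

end IsHyperellipticModel

/-! ### Valuation rings containing `x` -/

namespace ValuationSubring

variable {k K : Type*} [Field k] [Field K] [Algebra k K] {P : ValuationSubring K}

theorem mul_lt_one_of_le {a b : P.ValueGroup} (ha : a ≤ 1) (hb : b < 1) : a * b < 1 :=
  (mul_le_of_le_one_left' ha).trans_lt hb

theorem valuation_algebraMap (hk : ∀ c : k, algebraMap k K c ∈ P) {c : k} (hc : c ≠ 0) :
    P.valuation (algebraMap k K c) = 1 := by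
  apply le_antisymm ((P.valuation_le_one_iff _).2 (hk c))
  have h1 := (P.valuation_le_one_iff _).2 (hk c⁻¹)
  rw [map_inv₀, map_inv₀] at h1
  have h0 : P.valuation (algebraMap k K c) ≠ 0 := by simpa using hc
  exact (inv_le_one₀ (zero_lt_iff.2 h0)).1 h1

theorem aeval_mem {x : K} (hk : ∀ c : k, algebraMap k K c ∈ P) (hx : x ∈ P) (A : k[X]) :
    aeval x A ∈ P := by
  induction A using Polynomial.induction_on' with
  | add p q hp hq => rw [map_add]; exact P.add_mem _ _ hp hq
  | monomial n a =>
    rw [aeval_monomial]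
    exact P.mul_mem _ _ (hk a) (pow_mem hx n)

theorem valuation_aeval_le_one {x : K} (hk : ∀ c : k, algebraMap k K c ∈ P) (hx : x ∈ P)
    (A : k[X]) : P.valuation (aeval x A) ≤ 1 :=
  (P.valuation_le_one_iff _).2 (aeval_mem hk hx A)

/-- A generates a proper ideal of k[x], and a proper ideal of a subring lies in the nonunits of some
valuation ring of K containing the subring. -/
theorem exists_of_not_isUnit {x : K} (hx : Transcendental k x) {A : k[X]} (hA : ¬ IsUnit A) :
    ∃ P : ValuationSubring K, (∀ c : k, algebraMap k K c ∈ P) ∧ x ∈ P ∧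
      P.valuation (aeval x A) < 1 := by
  let R : Subring K := (aeval x : k[X] →ₐ[k] K).toRingHom.range
  let a : R := ⟨aeval x A, A, rfl⟩
  have hI : Ideal.span {a} ≠ ⊤ := by
    rw [Ne, Ideal.eq_top_iff_one, Ideal.mem_span_singleton]
    rintro ⟨⟨_, B, rfl⟩, hB⟩
    have h1 := congrArg Subtype.val hB
    have h2 : A * B = 1 := by
      have h3 : aeval x (A * B - 1) = 0 := by
        simpa [sub_eq_zero] using h1.symm
      exact sub_eq_zero.1 (transcendental_iff.1 hx _ h3)
    exact hA (IsUnit.of_mul_eq_one _ h2)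
  obtain ⟨P, hP, hP'⟩ := Ideal.image_subset_nonunits_valuationSubring _ hI
  refine ⟨P, fun c => hP ⟨C c, by simp⟩, hP ⟨X, by simp⟩, ?_⟩
  exact (ValuationSubring.mem_nonunits_iff P).1 (hP' ⟨a, Ideal.mem_span_singleton_self a, rfl⟩)

theorem ne_top_of_valuation_lt_one {a : K} (ha : a ≠ 0) (h : P.valuation a < 1) : P ≠ ⊤ := by
  rintro rfl
  have h1 := ((⊤ : ValuationSubring K).valuation_le_one_iff _).2 (mem_top a⁻¹)
  rw [map_inv₀] at h1
  have h0 : (⊤ : ValuationSubring K).valuation a ≠ 0 := by simpa using ha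
  exact absurd ((inv_le_one₀ (zero_lt_iff.2 h0)).1 h1) (not_le.2 h)

end ValuationSubring

/-! ### Local rings and regular functions on the affine chart -/

namespace IsHyperellipticModel

variable {k K : Type*} [Field k] [Field K] [Algebra k K] {g : ℕ} {f : k[X]} {x y : K}
  {P : ValuationSubring K}

theorem y_mem (h : IsHyperellipticModel g f x y) (hk : ∀ c : k, algebraMap k K c ∈ P)
    (hx : x ∈ P) : y ∈ P := by
  rw [← P.valuation_le_one_iff]
  have := ValuationSubring.valuation_aeval_le_one hk hx f
  rw [← h.sq_eq, map_pow] at this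
  exact (pow_le_one_iff two_ne_zero).1 this

theorem not_valuation_lt (hk : ∀ c : k, algebraMap k K c ∈ P) (hx : x ∈ P)
    {A B C a b c : k[X]} (e : a * A + b * B + c * C = 1) (hA : P.valuation (aeval x A) < 1)
    (hB : P.valuation (aeval x B) < 1) (hC : P.valuation (aeval x C) < 1) : False := by
  have hm : ∀ p q : k[X], P.valuation (aeval x q) < 1 → P.valuation (aeval x (p * q)) < 1 := by
    intro p q hq
    rw [map_mul, map_mul]
    exact ValuationSubring.mul_lt_one_of_le (ValuationSubring.valuation_aeval_le_one hk hx p) hq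
  have := P.valuation.map_add_lt (P.valuation.map_add_lt (hm a A hA) (hm b B hB)) (hm c C hC)
  rw [← map_add, ← map_add, e] at this
  simp at this

/-- f is squarefree, so where it vanishes it vanishes to order one as a function of x. In f = DE
with D = gcd(A, f), separability forbids D and E to vanish together; D vanishes at P, so E is a unit
there. -/
theorem valuation_aeval_le (h : IsHyperellipticModel g f x y)
    (hk : ∀ c : k, algebraMap k K c ∈ P) (hx : x ∈ P) {A : k[X]}
    (hA : P.valuation (aeval x A) < 1) (hf : P.valuation (aeval x f) < 1) :
    P.valuation (aeval x A) ≤ P.valuation (aeval x f) := by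
  obtain ⟨D, A', E, hD, hA', hE, a, c, e⟩ := exists_dvd_two A f h.ne_zero
  have h1 := fun p => ValuationSubring.valuation_aeval_le_one (P := P) hk hx p
  have hDlt : P.valuation (aeval x D) < 1 := by
    have : D = a * A + c * f := by
      rw [hA', hE]; linear_combination (-D) * e
    rw [this, map_add, map_mul, map_mul]
    apply P.valuation.map_add_lt
    · rw [map_mul]; exact ValuationSubring.mul_lt_one_of_le (h1 a) hA
    · rw [map_mul]; exact ValuationSubring.mul_lt_one_of_le (h1 c) hf
  have hE1 : P.valuation (aeval x E) = 1 := by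
    apply le_antisymm (h1 E)
    by_contra! hlt
    obtain ⟨u, w, huw⟩ := h.separable
    rw [hE, derivative_mul] at huw
    exact not_valuation_lt hk hx (A := E) (B := D) (C := E)
      (a := u * D) (b := w * derivative E) (c := w * derivative D) (by linear_combination huw)
      hlt hDlt hlt
  rw [hA', hE, map_mul, map_mul, map_mul, map_mul, hE1, mul_one]
  exact mul_le_of_le_one_right' (h1 A')

theorem valuation_y_sq (h : IsHyperellipticModel g f x y) :
    P.valuation (aeval x f) = P.valuation y ^ 2 := by rw [← h.sq_eq, map_pow]

theorem valuation_y_lt_sq (h : IsHyperellipticModel g f x y) (hy : P.valuation y < 1) :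
    P.valuation y ^ 2 < P.valuation y := by
  have h0 : P.valuation y ≠ 0 := by simpa using h.y_ne_zero
  rw [sq]
  exact mul_lt_of_lt_one_left (zero_lt_iff.2 h0) hy

theorem valuation_two (h : IsHyperellipticModel g f x y)
    (hk : ∀ c : k, algebraMap k K c ∈ P) : P.valuation (2 : K) = 1 := by
  simpa only [map_ofNat] using ValuationSubring.valuation_algebraMap hk h.two_ne

/-- The local ring of a point of the affine chart is a localization of `k[x, y]`. -/
theorem exists_local_fraction (h : IsHyperellipticModel g f x y)
    (hk : ∀ c : k, algebraMap k K c ∈ P) (hx : x ∈ P) {b : K} (hb : b ∈ P) :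
    ∃ A B A' B' : k[X], P.valuation (aeval x A' + aeval x B' * y) = 1 ∧
      b * (aeval x A' + aeval x B' * y) = aeval x A + aeval x B * y := by
  obtain ⟨A, B, C, hC, e, p, q, r, hpqr⟩ := h.exists_fraction b
  have h1 := fun p => ValuationSubring.valuation_aeval_le_one (P := P) hk hx p
  rw [← P.valuation_le_one_iff] at hb
  have hyP := (P.valuation_le_one_iff _).2 (h.y_mem hk hx)
  by_cases hCv : P.valuation (aeval x C) = 1
  · exact ⟨A, B, C, 0, by simpa using hCv, by simpa using e⟩
  replace hCv := lt_of_le_of_ne (h1 C) hCv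
  have hbC : P.valuation (b * aeval x C) < 1 := by
    rw [map_mul]; exact ValuationSubring.mul_lt_one_of_le hb hCv
  by_cases hy : P.valuation y = 1
  -- Where y is a unit the fraction is rationalized: b = (A² − B²f)/(C(A − By)). If A − By vanished
  -- at P, then so would A, B and C.
  · have hconj : P.valuation (aeval x A - aeval x B * y) = 1 := by
      by_contra hne
      have hlt : P.valuation (aeval x A - aeval x B * y) < 1 :=
        lt_of_le_of_ne (P.valuation.map_sub_le (h1 A)
          (by rw [map_mul, hy, mul_one]; exact h1 B)) hne
      have hA : P.valuation (aeval x A) < 1 := by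
        have e2 : 2 * aeval x A = b * aeval x C + (aeval x A - aeval x B * y) := by
          rw [e]; ring
        have := P.valuation.map_add_lt hbC hlt
        rwa [← e2, map_mul, h.valuation_two hk, one_mul] at this
      have hB : P.valuation (aeval x B) < 1 := by
        have e2 : aeval x B * y = b * aeval x C - aeval x A := by rw [e]; ring
        have := P.valuation.map_sub_lt hbC hA
        rwa [← e2, map_mul, hy, mul_one] at this
      exact not_valuation_lt hk hx hpqr hA hB hCv
    obtain ⟨D, U, V, hD, hU, hV, a, c, e2⟩ := exists_dvd_two (A ^ 2 - B ^ 2 * f) C hC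
    have e3 : b * (aeval x A - aeval x B * y) * aeval x V = aeval x U := by
      apply mul_left_cancel₀ (h.aeval_ne_zero hD)
      have hU' := congrArg (aeval x) hU
      have hV' := congrArg (aeval x) hV
      simp only [map_mul, map_sub, map_pow, ← h.sq_eq] at hU' hV'
      rw [← hU']
      linear_combination (-b * (aeval x A - aeval x B * y)) * hV' + (aeval x A - aeval x B * y) * e
    have hVv : P.valuation (aeval x V) = 1 := by
      by_contra hne
      have hlt := lt_of_le_of_ne (h1 V) hne
      have hUlt : P.valuation (aeval x U) < 1 := by
        rw [← e3, map_mul, map_mul, hconj, mul_one]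
        exact ValuationSubring.mul_lt_one_of_le hb hlt
      exact not_valuation_lt hk hx (B := 0) (b := 0) (by simpa using e2) hUlt (by simp) hlt
    refine ⟨U, 0, A * V, -B * V, ?_, ?_⟩
    · have : aeval x (A * V) + aeval x (-B * V) * y =
        (aeval x A - aeval x B * y) * aeval x V := by simp; ring
      rw [this, map_mul, hconj, hVv, one_mul]
    · simp only [map_mul, map_neg, map_zero]
      linear_combination e3
  -- Where y vanishes, a vanishing C is impossible: A and C are then multiples of f = y² and B is a
  -- unit, so bC = A + By would make y a multiple of y².
  · exfalso
    replace hy := lt_of_le_of_ne hyP hy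
    have hf : P.valuation (aeval x f) < 1 := by
      rw [h.valuation_y_sq]; exact pow_lt_one₀ zero_le hy two_ne_zero
    have hA : P.valuation (aeval x A) < 1 := by
      have : aeval x A = b * aeval x C - aeval x B * y := by rw [e]; ring
      rw [this]
      exact P.valuation.map_sub_lt hbC (by rw [map_mul]; exact ValuationSubring.mul_lt_one_of_le (h1 B) hy)
    have hB : P.valuation (aeval x B) = 1 := by
      by_contra hne
      exact not_valuation_lt hk hx hpqr hA (lt_of_le_of_ne (h1 B) hne) hCv
    have : P.valuation y ≤ P.valuation (aeval x f) := by
      have e2 : aeval x B * y = b * aeval x C - aeval x A := by rw [e]; ring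
      rw [← one_mul (P.valuation y), ← hB, ← map_mul, e2]
      apply P.valuation.map_sub_le
      · rw [map_mul]
        exact (mul_le_of_le_one_left' hb).trans (h.valuation_aeval_le hk hx hCv hf)
      · exact h.valuation_aeval_le hk hx hA hf
    rw [h.valuation_y_sq] at this
    exact absurd (h.valuation_y_lt_sq hy) (not_lt.2 this)

/-- A function regular on the whole affine chart lies in `k[x, y]`. -/
theorem exists_of_forall_mem (h : IsHyperellipticModel g f x y) {b : K}
    (hb : ∀ P : ValuationSubring K, P ≠ ⊤ → (∀ c : k, algebraMap k K c ∈ P) → x ∈ P → b ∈ P) :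
    ∃ A B : k[X], b = aeval x A + aeval x B * y := by
  obtain ⟨A, B, C, hC, e, p, q, r, hpqr⟩ := h.exists_fraction b
  by_cases hCu : IsUnit C
  · obtain ⟨D, hD⟩ := hCu.exists_right_inv
    refine ⟨A * D, B * D, ?_⟩
    have hD' := congrArg (aeval x) hD
    simp only [map_mul, map_one] at hD' ⊢
    linear_combination (-b) * hD' + aeval x D * e
  exfalso
  obtain ⟨P, hk, hx, hCv⟩ := ValuationSubring.exists_of_not_isUnit h.transcendental hCu
  obtain ⟨σ, hσ, hσy⟩ := h.exists_conj'
  have h1 := fun p => ValuationSubring.valuation_aeval_le_one (P := P) hk hx p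
  have htop := ValuationSubring.ne_top_of_valuation_lt_one (h.aeval_ne_zero hC) hCv
  have hbP := (P.valuation_le_one_iff _).2 (hb P htop hk hx)
  -- The hypothesis also applies to the conjugate of `P`, which again contains k and x. Hence b and
  -- its conjugate are both regular at `P`, and so are their sum 2A/C and difference 2By/C.
  have hσb : P.valuation (σ b) ≤ 1 := by
    rw [P.valuation_le_one_iff]
    refine hb (P.comap (σ : K ≃+* K).toRingHom) ?_ ?_ ?_
    · intro ht
      apply htop
      ext z
      refine ⟨fun _ => trivial, fun _ => ?_⟩
      have : σ.symm z ∈ P.comap (σ : K ≃+* K).toRingHom := by rw [ht]; trivial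
      simpa [ValuationSubring.mem_comap] using this
    · intro c
      simpa [ValuationSubring.mem_comap] using hk c
    · have := hσ X
      rw [aeval_X] at this
      simpa [ValuationSubring.mem_comap, this] using hx
  have e' : σ b * aeval x C = aeval x A - aeval x B * y := by
    have := congrArg σ e
    simpa [hσ, hσy, sub_eq_add_neg] using this
  have h2 := h.valuation_two hk
  have hA : P.valuation (aeval x A) < 1 := by
    have e2 : 2 * aeval x A = (b + σ b) * aeval x C := by linear_combination -e - e'
    have := congrArg P.valuation e2
    rw [map_mul, h2, one_mul, map_mul] at this
    rw [this]
    exact ValuationSubring.mul_lt_one_of_le (P.valuation.map_add_le hbP hσb) hCv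
  have hBy : P.valuation (aeval x B) * P.valuation y ≤ P.valuation (aeval x C) := by
    have e2 : 2 * (aeval x B * y) = (b - σ b) * aeval x C := by linear_combination -e + e'
    have := congrArg P.valuation e2
    rw [map_mul, h2, one_mul, map_mul, map_mul] at this
    rw [this]
    exact mul_le_of_le_one_left' (P.valuation.map_sub_le hbP hσb)
  have hB : P.valuation (aeval x B) = 1 := by
    by_contra hne
    exact not_valuation_lt hk hx hpqr hA (lt_of_le_of_ne (h1 B) hne) hCv
  rw [hB, one_mul] at hBy
  have hy := hBy.trans_lt hCv
  have hf : P.valuation (aeval x f) < 1 := by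
    rw [h.valuation_y_sq]; exact pow_lt_one₀ zero_le hy two_ne_zero
  have := hBy.trans (h.valuation_aeval_le hk hx hCv hf)
  rw [h.valuation_y_sq] at this
  exact absurd (h.valuation_y_lt_sq hy) (not_lt.2 this)

end IsHyperellipticModel

/-! ### Differentials of the function field -/

namespace IsHyperellipticModel

section Differentials

open KaehlerDifferential

variable {k K : Type*} [Field k] [Field K] [Algebra k K] {g : ℕ} {f : k[X]} {x y : K}
  {P : ValuationSubring K}

theorem D_x (h : IsHyperellipticModel g f x y) : D k K x = y • (y⁻¹ • D k K x) := by
  rw [smul_smul, mul_inv_cancel₀ h.y_ne_zero, one_smul]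

theorem D_y (h : IsHyperellipticModel g f x y) :
    D k K y = (aeval x (derivative f) / 2) • (y⁻¹ • D k K x) := by
  have h1 := congrArg (D k K) h.sq_eq
  rw [Derivation.leibniz_pow, Derivation.map_aeval] at h1
  have h2 := h.two_ne'
  have hy := h.y_ne_zero
  have h3 : D k K y = ((2 : K)⁻¹ * y⁻¹) • ((2 : ℕ) • y ^ (2 - 1) • D k K y) := by
    rw [← Nat.cast_smul_eq_nsmul K, smul_smul, smul_smul]
    have : (2 : K)⁻¹ * y⁻¹ * ((2 : ℕ) : K) * y ^ (2 - 1) = 1 := by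
      push_cast
      field_simp
    rw [this, one_smul]
  rw [h3, h1, smul_smul, smul_smul]
  congr 1
  field_simp

theorem D_add_mul (h : IsHyperellipticModel g f x y) (A B : k[X]) :
    D k K (aeval x A + aeval x B * y) =
      ((aeval x (derivative A) + aeval x (derivative B) * y) * y +
        aeval x B * (aeval x (derivative f) / 2)) • (y⁻¹ • D k K x) := by
  rw [map_add, Derivation.leibniz, Derivation.map_aeval, Derivation.map_aeval, h.D_y]
  have hx := h.D_x
  set η := y⁻¹ • D k K x
  rw [hx]
  module

theorem _root_.KaehlerDifferential.D_eq_of_mul_eq {b w u cu cw : K} {η : Ω[K⁄k]} (hw : w ≠ 0)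
    (e : b * w = u) (hu : D k K u = cu • η) (hw' : D k K w = cw • η) :
    D k K b = ((cu - b * cw) * w⁻¹) • η := by
  rw [← e, Derivation.leibniz, hw'] at hu
  have : D k K b = w⁻¹ • (w • D k K b) := by rw [smul_smul, inv_mul_cancel₀ hw, one_smul]
  rw [this, ← sub_eq_of_eq_add' hu.symm]
  module

theorem exists_eq_smul (h : IsHyperellipticModel g f x y) (ω : Ω[K⁄k]) :
    ∃ a : K, ω = a • (y⁻¹ • D k K x) := by
  have hω : ω ∈ Submodule.span K (Set.range (D k K)) := by
    rw [span_range_derivation]; trivial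
  suffices ω ∈ Submodule.span K {y⁻¹ • D k K x} by
    obtain ⟨a, ha⟩ := Submodule.mem_span_singleton.1 this
    exact ⟨a, ha.symm⟩
  refine Submodule.span_le.2 ?_ hω
  rintro _ ⟨b, rfl⟩
  obtain ⟨A, B, C, hC, e, -⟩ := h.exists_fraction b
  have hw := h.D_add_mul C 0
  rw [map_zero, zero_mul, add_zero] at hw
  exact Submodule.mem_span_singleton.2
    ⟨_, (D_eq_of_mul_eq (h.aeval_ne_zero hC) e (h.D_add_mul A B) hw).symm⟩

/-- If dx = 0 then all differentials vanish, since dx/y spans them. A finitely generated field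
extension without differentials is separable algebraic, but x is transcendental. -/
theorem D_x_ne_zero (h : IsHyperellipticModel g f x y) : D k K x ≠ 0 := by
  intro h0
  have : Algebra.FormallyUnramified k K := by
    refine ⟨⟨fun a b => ?_⟩⟩
    obtain ⟨a', ha⟩ := h.exists_eq_smul a
    obtain ⟨b', hb⟩ := h.exists_eq_smul b
    rw [ha, hb, h0]
    simp
  have : Algebra.EssFiniteType k K := by
    have : Algebra.EssFiniteType k (⊤ : IntermediateField k K) := by
      rw [← h.adjoin_eq_top]
      exact IntermediateField.essFiniteType_iff.2
        (IntermediateField.fg_adjoin_of_finite (Set.toFinite _))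
    exact Algebra.EssFiniteType.of_surjective
      (IntermediateField.topEquiv (F := k) (E := K)).toAlgHom
      (IntermediateField.topEquiv (F := k) (E := K)).surjective
  have := Algebra.FormallyUnramified.isSeparable k K
  exact h.transcendental (Algebra.IsAlgebraic.isAlgebraic x)

theorem smul_injective (h : IsHyperellipticModel g f x y) {a b : K}
    (e : a • (y⁻¹ • D k K x) = b • (y⁻¹ • D k K x)) : a = b :=
  smul_left_injective K (smul_ne_zero (inv_ne_zero h.y_ne_zero) h.D_x_ne_zero) e

/-- At a point of the affine chart the module of regular differentials is generated by `dx / y`. -/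
theorem mem_local_iff (h : IsHyperellipticModel g f x y)
    (hk : ∀ c : k, algebraMap k K c ∈ P) (hx : x ∈ P) (ω : Ω[K⁄k]) :
    ω ∈ Submodule.span k {ω | ∃ a ∈ P, ∃ b ∈ P, ω = a • D k K b} ↔
      ∃ a ∈ P, ω = a • (y⁻¹ • D k K x) := by
  have hy := h.y_mem hk hx
  have hA := fun A => ValuationSubring.aeval_mem (P := P) hk hx A
  have h2 := h.two_ne'
  constructor
  · intro hω
    induction hω using Submodule.span_induction with
    | mem ω hω =>
      obtain ⟨a, ha, b, hb, rfl⟩ := hω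
      obtain ⟨A, B, A', B', hw, e⟩ := h.exists_local_fraction hk hx hb
      have hw0 : aeval x A' + aeval x B' * y ≠ 0 := by
        intro h0; rw [h0] at hw; simp at hw
      refine ⟨_, ?_, by rw [D_eq_of_mul_eq hw0 e (h.D_add_mul A B) (h.D_add_mul A' B'), smul_smul]⟩
      have hinv : (aeval x A' + aeval x B' * y)⁻¹ ∈ P := by
        rw [← P.valuation_le_one_iff, map_inv₀, hw, inv_one]
      have h2P : (2 : K)⁻¹ ∈ P := by
        rw [← P.valuation_le_one_iff, map_inv₀, h.valuation_two hk, inv_one]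
      have hc : ∀ A B : k[X], (aeval x (derivative A) + aeval x (derivative B) * y) * y +
          aeval x B * (aeval x (derivative f) / 2) ∈ P := fun A B => by
        rw [div_eq_mul_inv]
        exact add_mem (mul_mem (add_mem (hA _) (mul_mem (hA _) hy)) hy)
          (mul_mem (hA _) (mul_mem (hA _) h2P))
      exact mul_mem ha (mul_mem (sub_mem (hc _ _) (mul_mem hb (hc _ _))) hinv)
    | zero => exact ⟨0, zero_mem _, by simp⟩
    | add a b _ _ ha hb =>
      obtain ⟨r, hr, rfl⟩ := ha
      obtain ⟨s, hs, rfl⟩ := hb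
      exact ⟨r + s, add_mem hr hs, by rw [add_smul]⟩
    | smul c a _ ha =>
      obtain ⟨r, hr, rfl⟩ := ha
      exact ⟨algebraMap k K c * r, mul_mem (hk c) hr, by rw [mul_smul, algebraMap_smul]⟩
  · rintro ⟨a, ha, rfl⟩
    obtain ⟨p, q, e⟩ := h.separable
    have e' := congrArg (aeval x) e
    simp only [map_add, map_mul, map_one, ← h.sq_eq] at e'
    -- From pf + qf′ = 1, y² = f and 2y dy = f′ dx it follows that dx/y = py dx + 2q dy, visibly
    -- regular.
    have : a • (y⁻¹ • D k K x) =
        (a * aeval x p * y) • D k K x + (a * aeval x q * 2) • D k K y := by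
      have hx := h.D_x
      rw [h.D_y]
      generalize y⁻¹ • D k K x = η at hx ⊢
      rw [hx, smul_smul, smul_smul, ← add_smul]
      congr 1
      field_simp
      linear_combination (-a) * e'
    rw [this]
    have h2m : (2 : K) ∈ P := by simpa only [map_ofNat] using hk 2
    exact add_mem
      (Submodule.subset_span ⟨_, mul_mem (mul_mem ha (hA _)) hy, _, hx, rfl⟩)
      (Submodule.subset_span ⟨_, mul_mem (mul_mem ha (hA _)) h2m, _, hy, rfl⟩)

/-- The factor is −x^(g−1), written without subtraction in the exponent so that g = 0 is covered. -/
theorem inv_differential (h : IsHyperellipticModel g f x y) :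
    (y * x⁻¹ ^ (g + 1))⁻¹ • D k K x⁻¹ = (-(x ^ g * x⁻¹)) • (y⁻¹ • D k K x) := by
  have hx := h.x_ne_zero
  rw [Derivation.leibniz_inv, smul_smul, smul_smul]
  congr 1
  rw [mul_inv, inv_pow, inv_inv, pow_succ]
  field_simp

/-- Regularity on the chart of x makes the coefficient of dx/y equal to A(x) + B(x)y. At infinity
−x^(1−g) times it must be a polynomial in 1/x and y/x^(g+1). The y-part forces B = 0, and the rest
bounds deg A by g − 1. -/
theorem forall_mem_local_iff [PerfectField k] (h : IsHyperellipticModel g f x y) (ω : Ω[K⁄k]) :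
    (∀ P : ValuationSubring K, P ≠ ⊤ → (∀ c : k, algebraMap k K c ∈ P) →
      ω ∈ Submodule.span k {ω | ∃ a ∈ P, ∃ b ∈ P, ω = a • D k K b}) ↔
      ∃ A ∈ degreeLT k g, ω = aeval x A • (y⁻¹ • D k K x) := by
  have hinv := h.inv
  have hx0 := h.x_ne_zero
  have hη := h.inv_differential
  constructor
  · intro hω
    obtain ⟨b, rfl⟩ := h.exists_eq_smul ω
    have h1 : ∃ A B : k[X], b = aeval x A + aeval x B * y := by
      refine h.exists_of_forall_mem fun P hP hk hx => ?_
      obtain ⟨a, ha, e⟩ := (h.mem_local_iff hk hx _).1 (hω P hP hk)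
      exact (h.smul_injective e) ▸ ha
    have h2 : ∃ A B : k[X], -(b * (x * x⁻¹ ^ g)) =
        aeval x⁻¹ A + aeval x⁻¹ B * (y * x⁻¹ ^ (g + 1)) := by
      refine hinv.exists_of_forall_mem fun P hP hk hx => ?_
      obtain ⟨a, ha, e⟩ := (hinv.mem_local_iff hk hx _).1 (hω P hP hk)
      rw [hη, smul_smul a] at e
      have := h.smul_injective e
      have h3 : -(b * (x * x⁻¹ ^ g)) = a := by
        have h4 : x ^ g * x⁻¹ * (x * x⁻¹ ^ g) = 1 := by
          rw [mul_assoc, inv_mul_cancel_left₀ hx0, ← mul_pow, mul_inv_cancel₀ hx0, one_pow]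
        rw [this]
        linear_combination a * h4
      rwa [h3]
    obtain ⟨A, B, hb⟩ := h1
    obtain ⟨A', B', hb'⟩ := h2
    obtain ⟨N, hN⟩ : ∃ N, N = max A'.natDegree B'.natDegree := ⟨_, rfl⟩
    have eA := aeval_inv_reflect_mul_pow (inv_ne_zero hx0) (le_max_left A'.natDegree B'.natDegree)
    have eB := aeval_inv_reflect_mul_pow (inv_ne_zero hx0) (le_max_right A'.natDegree B'.natDegree)
    rw [inv_inv, ← hN] at eA eB
    -- Comparison of the two expressions after clearing the negative powers of x. B ≠ 0 would give
    -- the first term of the y-part degree at least N + 2, while the reflected term has degree at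
    -- most N.
    have key := h.poly_eq_zero (A := X ^ (N + 2) * A + X ^ (g + 1) * A'.reflect N)
      (B := X ^ (N + 2) * B + B'.reflect N) (by
        rw [hb, ← eA, ← eB] at hb'
        simp only [map_add, map_mul, map_pow, aeval_X]
        generalize aeval x (A'.reflect N) = a at hb' ⊢
        generalize aeval x (B'.reflect N) = b at hb' ⊢
        generalize aeval x A = c at hb' ⊢
        generalize aeval x B = d at hb' ⊢
        have h4 : ∀ n, x⁻¹ ^ n * x ^ n = 1 := fun n => by
          rw [← mul_pow, inv_mul_cancel₀ hx0, one_pow]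
        have h5 := h4 N
        have h6 := h4 g
        have h7 : x⁻¹ * x = 1 := inv_mul_cancel₀ hx0
        simp only [pow_succ] at hb' ⊢
        generalize x⁻¹ ^ N = p at *
        generalize x⁻¹ ^ g = q at *
        generalize x ^ N = P at *
        generalize x ^ g = Q at *
        generalize x⁻¹ = t at *
        linear_combination (-P * Q * x) * hb' - (x * Q * a + b * y * q * Q * t * x) * h5
          - (x ^ 2 * P * (c + d * y) + b * y * t * x) * h6 - b * y * h7)
    have hB : B = 0 := by
      by_contra hB
      have h3 := congrArg natDegree (eq_neg_of_add_eq_zero_left key.2)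
      rw [natDegree_neg, mul_comm, natDegree_mul_X_pow _ hB] at h3
      have := natDegree_reflect_le' (hN ▸ le_max_right A'.natDegree B'.natDegree)
      omega
    subst hB
    refine ⟨A, ?_, by rw [hb]; simp⟩
    rw [mem_degreeLT]
    by_cases hA : A = 0
    · simp [hA]
    have h3 := congrArg natDegree (eq_neg_of_add_eq_zero_left key.1)
    rw [natDegree_neg, mul_comm, natDegree_mul_X_pow _ hA] at h3
    have h4 := natDegree_reflect_le' (hN ▸ le_max_left A'.natDegree B'.natDegree)
    have h5 := natDegree_mul_le (p := X ^ (g + 1)) (q := A'.reflect N)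
    rw [natDegree_X_pow] at h5
    rw [degree_eq_natDegree hA]
    norm_cast
    omega
  · rintro ⟨A, hA, rfl⟩ P hP hk
    rcases P.mem_or_inv_mem x with hx | hx
    · exact (h.mem_local_iff hk hx _).2 ⟨_, ValuationSubring.aeval_mem hk hx A, rfl⟩
    · by_cases hA0 : A = 0
      · simp [hA0]
      -- The coefficient at infinity is −x^(1−g)A(x), a polynomial in 1/x. As A ≠ 0 forces g ≥ 1, `g
      -- - 1` is not truncated.
      refine (hinv.mem_local_iff hk hx _).2
        ⟨-aeval x⁻¹ (A.reflect (g - 1)), neg_mem (ValuationSubring.aeval_mem hk hx _), ?_⟩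
      rw [mem_degreeLT, degree_eq_natDegree hA0] at hA
      have hA' : A.natDegree < g := by exact_mod_cast hA
      rw [hη, smul_smul (-_ : K),
        ← aeval_inv_reflect_mul_pow hx0 (N := g - 1) (by omega : A.natDegree ≤ g - 1)]
      congr 1
      obtain ⟨m, rfl⟩ : ∃ m, g = m + 1 := ⟨g - 1, by omega⟩
      simp only [Nat.add_sub_cancel]
      rw [pow_succ]
      field_simp

end Differentials

end IsHyperellipticModel

/-! ### The genus, and the independence of k(x) -/

namespace SmoothProjCurve

open KaehlerDifferential

variable {k : Type u} [Field k] [PerfectField k] {C : SmoothProjCurve.{u, v} k} {g : ℕ} {f : k[X]}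
  {x y : C.K}

theorem mem_regularDifferentials_iff (h : IsHyperellipticModel g f x y) (ω : Ω[C.K⁄k]) :
    ω ∈ C.regularDifferentials ↔
      ∃ A ∈ degreeLT k g, ω = aeval x A • (y⁻¹ • D k C.K x) := by
  rw [← h.forall_mem_local_iff, regularDifferentials]
  simp only [Submodule.mem_iInf]
  exact ⟨fun H P hP hk => H P ⟨hP, hk⟩, fun H P hP => H P hP.1 hP.2⟩

theorem genus_eq (h : IsHyperellipticModel g f x y) : C.genus = g := by
  let L : degreeLT k g →ₗ[k] Ω[C.K⁄k] :=
    ((LinearMap.toSpanSingleton C.K Ω[C.K⁄k] (y⁻¹ • D k C.K x)).restrictScalars k ∘ₗ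
      (aeval x).toLinearMap) ∘ₗ (degreeLT k g).subtype
  have hL : ∀ A, L A = aeval x (A : k[X]) • (y⁻¹ • D k C.K x) := fun A => rfl
  have hinj : Function.Injective L := by
    intro A B e
    rw [hL, hL] at e
    exact Subtype.ext (h.aeval_injective (h.smul_injective e))
  have hr : C.regularDifferentials = LinearMap.range L := by
    ext ω
    rw [mem_regularDifferentials_iff h]
    constructor
    · rintro ⟨A, hA, rfl⟩
      exact ⟨⟨A, hA⟩, rfl⟩
    · rintro ⟨A, rfl⟩
      exact ⟨A, A.2, rfl⟩
  rw [genus, hr, LinearMap.finrank_range_of_inj hinj, (degreeLTEquiv k g).finrank_eq]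
  simp

/-- For g ≥ 2 both dx/y and x dx/y are regular. In the other model they are A(x′) and B(x′) times
the same differential, so their quotient x lies in k(x′). -/
theorem adjoin_le_of_model {g' : ℕ} {f' : k[X]} {x' y' : C.K} (hg : 2 ≤ g)
    (h : IsHyperellipticModel g f x y) (h' : IsHyperellipticModel g' f' x' y') :
    k⟮x⟯ ≤ k⟮x'⟯ := by
  rw [IntermediateField.adjoin_simple_le_iff]
  have h1 : (1 : k[X]) ∈ degreeLT k g := by
    rw [mem_degreeLT, degree_one]; exact_mod_cast (by omega : 0 < g)
  have hX : (X : k[X]) ∈ degreeLT k g := by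
    rw [mem_degreeLT, degree_X]; exact_mod_cast (by omega : 1 < g)
  obtain ⟨A, -, hA⟩ := (mem_regularDifferentials_iff h' _).1
    ((mem_regularDifferentials_iff h _).2 ⟨1, h1, rfl⟩)
  obtain ⟨B, -, hB⟩ := (mem_regularDifferentials_iff h' _).1
    ((mem_regularDifferentials_iff h _).2 ⟨X, hX, rfl⟩)
  rw [map_one, one_smul] at hA
  rw [aeval_X, hA, smul_smul] at hB
  have e := h'.smul_injective hB
  have hA0 : aeval x' A ≠ 0 := by
    intro h0
    rw [h0, zero_smul] at hA
    exact smul_ne_zero (inv_ne_zero h.y_ne_zero) h.D_x_ne_zero hA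
  rw [eq_div_of_mul_eq hA0 e]
  exact div_mem (aeval_mem_adjoin _ _) (aeval_mem_adjoin _ _)

theorem adjoin_eq_of_model {g' : ℕ} {f' : k[X]} {x' y' : C.K} (hg : 2 ≤ C.genus)
    (h : IsHyperellipticModel g f x y) (h' : IsHyperellipticModel g' f' x' y') :
    k⟮x⟯ = k⟮x'⟯ :=
  le_antisymm (adjoin_le_of_model (genus_eq h ▸ hg) h h')
    (adjoin_le_of_model (genus_eq h' ▸ hg) h' h)

end SmoothProjCurve

/-! ### Rational points and their coordinates -/

theorem Set.encard_eq_of_rel {α β : Type*} [Nonempty β] {S : Set α} {T : Set β} (R : α → β → Prop)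
    (h1 : ∀ a ∈ S, ∃ b ∈ T, R a b) (h2 : ∀ b ∈ T, ∃ a ∈ S, R a b)
    (h3 : ∀ a b b', R a b → R a b' → b = b') (h4 : ∀ a a' b, R a b → R a' b → a = a') :
    S.encard = T.encard := by
  choose! F hF using h1
  have hinj : Set.InjOn F S := by
    intro a ha a' ha' e
    exact h4 a a' (F a) (hF a ha).2 (e ▸ (hF a' ha').2)
  rw [← hinj.encard_image]
  congr 1
  ext b
  constructor
  · rintro ⟨a, ha, rfl⟩
    exact (hF a ha).1
  · intro hb
    obtain ⟨a, ha, hab⟩ := h2 b hb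
    exact ⟨a, ha, h3 _ _ _ (hF a ha).2 hab⟩

/-- The valuation ring `P` is centred at the point of the affine plane with coordinates `p`. -/
structure ValuationSubring.IsCenteredAt {k K : Type*} [Field k] [Field K] [Algebra k K]
    (P : ValuationSubring K) (x y : K) (p : k × k) : Prop where
  algebraMap_mem : ∀ c : k, algebraMap k K c ∈ P
  mem : x ∈ P
  lt_fst : P.valuation (x - algebraMap k K p.1) < 1
  lt_snd : P.valuation (y - algebraMap k K p.2) < 1

namespace ValuationSubring

variable {k K : Type*} [Field k] [Field K] [Algebra k K] {P : ValuationSubring K}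

theorem eq_of_valuation_sub_lt (hk : ∀ c : k, algebraMap k K c ∈ P) {a : K} {c d : k}
    (hc : P.valuation (a - algebraMap k K c) < 1) (hd : P.valuation (a - algebraMap k K d) < 1) :
    c = d := by
  by_contra hne
  have := P.valuation.map_sub_lt hd hc
  rw [sub_sub_sub_cancel_left, ← map_sub, valuation_algebraMap hk (sub_ne_zero.2 hne)] at this
  exact lt_irrefl _ this

theorem valuation_eq_one_of_sub_lt (hk : ∀ c : k, algebraMap k K c ∈ P) {a : K} {c : k}
    (hc : P.valuation (a - algebraMap k K c) < 1) (hc0 : c ≠ 0) : P.valuation a = 1 := by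
  have h1 := valuation_algebraMap hk hc0
  have := P.valuation.map_add_eq_of_lt_right (hc.trans_eq h1.symm)
  rwa [sub_add_cancel, h1] at this

theorem valuation_aeval_sub_le {x : K} (hk : ∀ c : k, algebraMap k K c ∈ P) (hx : x ∈ P) (A : k[X])
    (c : k) : P.valuation (aeval x A - algebraMap k K (A.eval c)) ≤
      P.valuation (x - algebraMap k K c) := by
  obtain ⟨B, hB⟩ := X_sub_C_dvd_sub_C_eval (a := c) (p := A)
  have := congrArg (aeval x) hB
  simp only [map_sub, map_mul, aeval_C, aeval_X] at this
  rw [this, map_mul]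
  exact mul_le_of_le_one_right' (valuation_aeval_le_one hk hx B)

theorem valuation_lt_one_iff_inv {a : K} : P.valuation a < 1 ↔ a = 0 ∨ a⁻¹ ∉ P := by
  rw [← mem_nonunits_iff, mem_nonunits_iff_or]

theorem valuation_comap_lt_one {σ : K ≃ₐ[k] K} {a : K} :
    (P.comap (σ : K ≃+* K).toRingHom).valuation a < 1 ↔ P.valuation (σ a) < 1 := by
  rw [valuation_lt_one_iff_inv, valuation_lt_one_iff_inv, mem_comap]
  simp

end ValuationSubring

namespace IsHyperellipticModel

open ValuationSubring

variable {k K : Type*} [Field k] [Field K] [Algebra k K] {g : ℕ} {f : k[X]} {x y : K}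
  {P : ValuationSubring K} {p : k × k}

theorem valuation_add_mul_sub_lt (h : IsHyperellipticModel g f x y) (hp : P.IsCenteredAt x y p)
    (A B : k[X]) : P.valuation (aeval x A + aeval x B * y -
      algebraMap k K (A.eval p.1 + B.eval p.1 * p.2)) < 1 := by
  have hk := hp.algebraMap_mem
  have hA := (valuation_aeval_sub_le hk hp.mem A p.1).trans_lt hp.lt_fst
  have hB := (valuation_aeval_sub_le hk hp.mem B p.1).trans_lt hp.lt_fst
  have hy := (P.valuation_le_one_iff _).2 (h.y_mem hk hp.mem)
  have : aeval x A + aeval x B * y - algebraMap k K (A.eval p.1 + B.eval p.1 * p.2) =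
      (aeval x A - algebraMap k K (A.eval p.1)) +
        (y * (aeval x B - algebraMap k K (B.eval p.1)) +
          algebraMap k K (B.eval p.1) * (y - algebraMap k K p.2)) := by
    simp only [map_add, map_mul]; ring
  rw [this]
  refine P.valuation.map_add_lt hA (P.valuation.map_add_lt ?_ ?_)
  · rw [map_mul]; exact mul_lt_one_of_le hy hB
  · rw [map_mul]; exact mul_lt_one_of_le ((P.valuation_le_one_iff _).2 (hk _)) hp.lt_snd

theorem sq_eq_of_isCenteredAt (h : IsHyperellipticModel g f x y) (hp : P.IsCenteredAt x y p) :
    p.2 ^ 2 = f.eval p.1 := by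
  have hk := hp.algebraMap_mem
  have hf := (valuation_aeval_sub_le hk hp.mem f p.1).trans_lt hp.lt_fst
  rw [← h.sq_eq] at hf
  refine eq_of_valuation_sub_lt hk ?_ hf
  have hy := (P.valuation_le_one_iff _).2 (h.y_mem hk hp.mem)
  have : y ^ 2 - algebraMap k K (p.2 ^ 2) =
    (y + algebraMap k K p.2) * (y - algebraMap k K p.2) := by rw [map_pow]; ring
  rw [this, map_mul]
  exact mul_lt_one_of_le
    (P.valuation.map_add_le hy ((P.valuation_le_one_iff _).2 (hk _))) hp.lt_snd

/-- An element of `P` is a quotient of elements of k[x, y] whose denominator does not vanish at p.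
This condition involves only the centre, so the quotient is regular at `P'` too. -/
theorem le_of_isCenteredAt (h : IsHyperellipticModel g f x y) {P' : ValuationSubring K}
    (hp : P.IsCenteredAt x y p) (hp' : P'.IsCenteredAt x y p) : P ≤ P' := by
  intro b hb
  obtain ⟨A, B, A', B', hw, e⟩ := h.exists_local_fraction hp.algebraMap_mem hp.mem hb
  have hw0 : A'.eval p.1 + B'.eval p.1 * p.2 ≠ 0 := by
    intro h0
    have := h.valuation_add_mul_sub_lt hp A' B'
    rw [h0, map_zero, sub_zero, hw] at this
    exact lt_irrefl _ this
  have hw' := valuation_eq_one_of_sub_lt hp'.algebraMap_mem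
    (h.valuation_add_mul_sub_lt hp' A' B') hw0
  have hu : aeval x A + aeval x B * y ∈ P' :=
    have hA := fun A => ValuationSubring.aeval_mem hp'.algebraMap_mem hp'.mem A
    add_mem (hA A) (mul_mem (hA B) (h.y_mem hp'.algebraMap_mem hp'.mem))
  rw [← P'.valuation_le_one_iff, ← e, map_mul, hw', mul_one] at hu
  exact (P'.valuation_le_one_iff _).1 hu

/-- Some valuation ring has x − p.1 in its maximal ideal. There y reduces to p.2 or to −p.2, and in
the second case the conjugate ring is taken. -/
theorem exists_isCenteredAt (h : IsHyperellipticModel g f x y) (hp : p.2 ^ 2 = f.eval p.1) :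
    ∃ P : ValuationSubring K, P.IsCenteredAt x y p := by
  obtain ⟨P, hk, hx, hlt⟩ := exists_of_not_isUnit h.transcendental (not_isUnit_X_sub_C p.1)
  simp only [map_sub, aeval_X, aeval_C] at hlt
  have hf := (valuation_aeval_sub_le hk hx f p.1).trans_lt hlt
  have e : aeval x f - algebraMap k K (f.eval p.1) =
    (y - algebraMap k K p.2) * (y + algebraMap k K p.2) := by
    rw [← hp, ← h.sq_eq, map_pow]; ring
  rw [e, map_mul] at hf
  by_cases h1 : P.valuation (y - algebraMap k K p.2) < 1
  · exact ⟨P, hk, hx, hlt, h1⟩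
  have h2 : P.valuation (y + algebraMap k K p.2) < 1 := by
    by_contra h2
    exact absurd hf (not_lt.2 (one_le_mul (not_lt.1 h1) (not_lt.1 h2)))
  obtain ⟨σ, hσx, hσy⟩ := h.exists_conj
  refine ⟨P.comap (σ : K ≃+* K).toRingHom, fun c => ?_, ?_, ?_, ?_⟩
  · simpa [mem_comap] using hk c
  · simpa [mem_comap, hσx] using hx
  · rw [valuation_comap_lt_one]; simpa [hσx] using hlt
  · rw [valuation_comap_lt_one, ← Valuation.map_neg]
    simpa [hσy, add_comm] using h2

theorem exists_residue (h : IsHyperellipticModel g f x y) (hp : P.IsCenteredAt x y p) {b : K}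
    (hb : b ∈ P) : ∃ c : k, P.valuation (b - algebraMap k K c) < 1 := by
  obtain ⟨A, B, A', B', hw, e⟩ := h.exists_local_fraction hp.algebraMap_mem hp.mem hb
  have h1 := h.valuation_add_mul_sub_lt hp A B
  have h2 := h.valuation_add_mul_sub_lt hp A' B'
  set w := aeval x A' + aeval x B' * y
  set u := aeval x A + aeval x B * y
  set w0 := A'.eval p.1 + B'.eval p.1 * p.2
  set u0 := A.eval p.1 + B.eval p.1 * p.2
  have hw0 : w0 ≠ 0 := by
    intro h0
    rw [h0, map_zero, sub_zero, hw] at h2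
    exact lt_irrefl _ h2
  have hw0' : algebraMap k K w0 ≠ 0 := by simpa using hw0
  refine ⟨u0 / w0, ?_⟩
  have : (b - algebraMap k K (u0 / w0)) * w =
      (u - algebraMap k K u0) - algebraMap k K (u0 / w0) * (w - algebraMap k K w0) := by
    rw [← e, map_div₀]
    field_simp
    ring
  have h3 : P.valuation ((b - algebraMap k K (u0 / w0)) * w) < 1 := by
    rw [this]
    refine P.valuation.map_sub_lt h1 ?_
    rw [map_mul]
    exact mul_lt_one_of_le ((P.valuation_le_one_iff _).2 (hp.algebraMap_mem _)) h2
  rwa [map_mul, hw, mul_one] at h3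

theorem ne_top_of_isCenteredAt (h : IsHyperellipticModel g f x y) (hp : P.IsCenteredAt x y p) :
    P ≠ ⊤ := by
  refine ne_top_of_valuation_lt_one (a := x - algebraMap k K p.1) ?_ hp.lt_fst
  have := h.aeval_ne_zero (X_sub_C_ne_zero p.1)
  simpa using this

/-- The rational points of the affine chart, possibly with a side condition, are given by their
coordinates. -/
theorem encard_affine (h : IsHyperellipticModel g f x y) (Q : ValuationSubring K → Prop)
    (Q' : k × k → Prop) (hQ : ∀ P p, P.IsCenteredAt x y p → (Q P ↔ Q' p)) :
    {P : ValuationSubring K | (P ≠ ⊤ ∧ ∀ c : k, algebraMap k K c ∈ P) ∧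
      (∀ a ∈ P, ∃ c : k, P.valuation (a - algebraMap k K c) < 1) ∧ x ∈ P ∧ Q P}.encard =
    {p : k × k | p.2 ^ 2 = f.eval p.1 ∧ Q' p}.encard := by
  symm
  apply Set.encard_eq_of_rel (fun p P => P.IsCenteredAt x y p)
  · rintro p ⟨hp, hp'⟩
    obtain ⟨P, hP⟩ := h.exists_isCenteredAt hp
    exact ⟨P, ⟨⟨h.ne_top_of_isCenteredAt hP, hP.algebraMap_mem⟩, fun a ha => h.exists_residue hP ha,
      hP.mem, (hQ P p hP).2 hp'⟩, hP⟩
  · rintro P ⟨⟨-, hk⟩, hr, hx, hPQ⟩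
    obtain ⟨x₀, hx₀⟩ := hr x hx
    obtain ⟨y₀, hy₀⟩ := hr y (h.y_mem hk hx)
    have hp : P.IsCenteredAt x y (x₀, y₀) := ⟨hk, hx, hx₀, hy₀⟩
    exact ⟨_, ⟨h.sq_eq_of_isCenteredAt hp, (hQ P _ hp).1 hPQ⟩, hp⟩
  · exact fun p P P' hP hP' => le_antisymm (h.le_of_isCenteredAt hP hP') (h.le_of_isCenteredAt hP' hP)
  · exact fun p p' P hP hP' => Prod.ext
      (eq_of_valuation_sub_lt hP.algebraMap_mem hP.lt_fst hP'.lt_fst)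
      (eq_of_valuation_sub_lt hP.algebraMap_mem hP.lt_snd hP'.lt_snd)

/-- Where p.2 ≠ 0, x − p.1 is a uniformizer: y + p.2 is a unit, so y − p.2 is a multiple of x − p.1.
-/
theorem valuation_le_of_isCenteredAt (h : IsHyperellipticModel g f x y)
    (hp : P.IsCenteredAt x y p) (hp0 : p.2 ≠ 0) {b : K} (hb : P.valuation b < 1) :
    P.valuation b ≤ P.valuation (x - algebraMap k K p.1) := by
  have hk := hp.algebraMap_mem
  obtain ⟨A, B, A', B', hw, e⟩ := h.exists_local_fraction hk hp.mem
    ((P.valuation_le_one_iff _).1 hb.le)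
  have hu : P.valuation (aeval x A + aeval x B * y) < 1 := by
    rwa [← e, map_mul, hw, mul_one]
  have hu0 : A.eval p.1 + B.eval p.1 * p.2 = 0 :=
    eq_of_valuation_sub_lt hk (h.valuation_add_mul_sub_lt hp A B) (by simpa using hu)
  have hy : P.valuation (y - algebraMap k K p.2) ≤ P.valuation (x - algebraMap k K p.1) := by
    have h1 := valuation_aeval_sub_le hk hp.mem f p.1
    have e1 : aeval x f - algebraMap k K (f.eval p.1) =
      (y - algebraMap k K p.2) * (y + algebraMap k K p.2) := by
      rw [← h.sq_eq_of_isCenteredAt hp, ← h.sq_eq, map_pow]; ring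
    have h2 : P.valuation (y + algebraMap k K p.2) = 1 := by
      refine valuation_eq_one_of_sub_lt hk (c := 2 * p.2) ?_ (mul_ne_zero h.two_ne hp0)
      have : y + algebraMap k K p.2 - algebraMap k K (2 * p.2) = y - algebraMap k K p.2 := by
        rw [map_mul, map_ofNat]; ring
      rw [this]
      exact hp.lt_snd
    rwa [e1, map_mul, h2, mul_one] at h1
  have e2 : aeval x A + aeval x B * y = (aeval x A - algebraMap k K (A.eval p.1)) +
      (y * (aeval x B - algebraMap k K (B.eval p.1)) +
        algebraMap k K (B.eval p.1) * (y - algebraMap k K p.2)) := by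
    have := congrArg (algebraMap k K) hu0
    simp only [map_add, map_mul, map_zero] at this
    linear_combination this
  have h3 : P.valuation b = P.valuation (aeval x A + aeval x B * y) := by
    rw [← e, map_mul, hw, mul_one]
  rw [h3, e2]
  refine P.valuation.map_add_le (valuation_aeval_sub_le hk hp.mem A _)
    (P.valuation.map_add_le ?_ ?_)
  · rw [map_mul]
    exact (mul_le_of_le_one_left' ((P.valuation_le_one_iff _).2 (h.y_mem hk hp.mem))).trans
      (valuation_aeval_sub_le hk hp.mem B _)
  · rw [map_mul]
    exact (mul_le_of_le_one_left' ((P.valuation_le_one_iff _).2 (hk _))).trans hy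

/-- If p.2 ≠ 0, the uniformizer x − p.1 lies in k(x) and not in the square of the maximal ideal. If
p.2 = 0, every function in k(x) vanishing at `P` is a multiple of f = y². -/
theorem ramified_iff (h : IsHyperellipticModel g f x y) (hp : P.IsCenteredAt x y p) :
    (∀ z : P, (z : K) ∈ k⟮x⟯ → z ∈ IsLocalRing.maximalIdeal P →
      z ∈ IsLocalRing.maximalIdeal P ^ 2) ↔ p.2 = 0 := by
  have hk := hp.algebraMap_mem
  constructor
  · intro hram
    by_contra hp0
    set t : K := x - algebraMap k K p.1 with ht
    have htP : t ∈ P := sub_mem hp.mem (hk _)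
    have ht2 := hram ⟨t, htP⟩
      (sub_mem (IntermediateField.mem_adjoin_simple_self _ _) (IntermediateField.algebraMap_mem _ _))
      ((P.valuation_lt_one_iff _).2 hp.lt_fst)
    have key : ∀ z ∈ IsLocalRing.maximalIdeal P ^ 2,
        P.valuation (z : K) ≤ P.valuation t * P.valuation t := by
      intro z hz
      rw [sq] at hz
      induction hz using Submodule.mul_induction_on' with
      | mem_mul_mem a ha b hb =>
        simp only [MulMemClass.coe_mul, map_mul]
        exact mul_le_mul'
          (h.valuation_le_of_isCenteredAt hp hp0 ((P.valuation_lt_one_iff _).1 ha))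
          (h.valuation_le_of_isCenteredAt hp hp0 ((P.valuation_lt_one_iff _).1 hb))
      | add a _ b _ ha hb => exact P.valuation.map_add_le ha hb
    have h1 := key _ ht2
    have ht0 : P.valuation t ≠ 0 := by
      have := h.aeval_ne_zero (X_sub_C_ne_zero p.1)
      simpa [ht] using this
    exact absurd (mul_lt_of_lt_one_left (zero_lt_iff.2 ht0) hp.lt_fst) (not_lt.2 h1)
  · intro hp0 z hz hzm
    have hz1 := (P.valuation_lt_one_iff _).1 hzm
    have hy : P.valuation y < 1 := by simpa [hp0] using hp.lt_snd
    have hf : P.valuation (aeval x f) < 1 := by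
      rw [h.valuation_y_sq]; exact pow_lt_one₀ zero_le hy two_ne_zero
    obtain ⟨U, V, ⟨a, c, hUV⟩, hV, e⟩ := exists_coprime_of_mem_adjoin h.transcendental hz
    have hVle := valuation_aeval_le_one hk hp.mem V
    have hU : P.valuation (aeval x U) < 1 := by
      rw [← e, map_mul, mul_comm]; exact mul_lt_one_of_le hVle hz1
    have hV1 : P.valuation (aeval x V) = 1 := by
      by_contra hne
      exact not_valuation_lt hk hp.mem (B := 0) (b := 0) (by simpa using hUV) hU (by simp)
        (lt_of_le_of_ne hVle hne)
    have h1 := h.valuation_aeval_le hk hp.mem hU hf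
    rw [← e, map_mul, hV1, mul_one, ← h.sq_eq] at h1
    obtain ⟨b, hb⟩ := (P.valuation_le_iff _ _).1 h1
    have hyP := h.y_mem hk hp.mem
    have : z = b * (⟨y, hyP⟩ : P) ^ 2 := Subtype.ext hb.symm
    rw [this]
    exact Ideal.mul_mem_left _ _ (Ideal.pow_mem_pow ((P.valuation_lt_one_iff _).2 hy) 2)

end IsHyperellipticModel

/-! ### Existence of a model; points and Weierstrass points counted on it -/

namespace SmoothProjCurve

variable {k : Type u} [Field k] {C : SmoothProjCurve.{u, v} k}

theorem IsDegreeTwoMap.transcendental {x : C.K} (hx : C.IsDegreeTwoMap x) : Transcendental k x := by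
  intro ha
  obtain ⟨t, ht, -⟩ := C.exists_finite
  apply ht
  have : FiniteDimensional k⟮x⟯ C.K :=
    FiniteDimensional.of_finrank_pos (by rw [show Module.finrank k⟮x⟯ C.K = 2 from hx]; norm_num)
  have h1 := IntermediateField.isAlgebraic_adjoin_simple ha.isIntegral
  have h2 : Algebra.IsAlgebraic k C.K := Algebra.IsAlgebraic.trans k k⟮x⟯ C.K
  exact Algebra.IsAlgebraic.isAlgebraic t

theorem IsDegreeTwoMap.exists_sq_eq (h2 : (2 : k) ≠ 0) {x : C.K} (hx : C.IsDegreeTwoMap x) :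
    ∃ (F : k[X]) (w : C.K), w ∉ k⟮x⟯ ∧ w ^ 2 = aeval x F := by
  have hfr : Module.finrank k⟮x⟯ C.K = 2 := hx
  have : FiniteDimensional k⟮x⟯ C.K := FiniteDimensional.of_finrank_pos (by rw [hfr]; norm_num)
  have h2K : (2 : C.K) ≠ 0 := by
    have := (map_ne_zero (algebraMap k C.K)).2 h2
    rwa [map_ofNat] at this
  obtain ⟨y, hy⟩ : ∃ y : C.K, y ∉ k⟮x⟯ := by
    by_contra! hall
    have : k⟮x⟯ = ⊤ := by ext z; simp [hall z]
    rw [this, IntermediateField.finrank_top] at hfr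
    omega
  have hdeg : (minpoly k⟮x⟯ y).degree ≤ 2 := by
    rw [degree_eq_natDegree (minpoly.ne_zero (Algebra.IsIntegral.isIntegral y))]
    exact_mod_cast hfr ▸ minpoly.natDegree_le y
  have hquad := eq_quadratic_of_degree_le_two hdeg
  have hroot := minpoly.aeval k⟮x⟯ y
  rw [hquad] at hroot
  set a := (minpoly k⟮x⟯ y).coeff 2
  set b := (minpoly k⟮x⟯ y).coeff 1
  set c := (minpoly k⟮x⟯ y).coeff 0
  simp only [map_add, map_mul, aeval_C, map_pow, aeval_X, IntermediateField.algebraMap_apply]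
    at hroot
  have ha : a ≠ 0 := by
    intro ha
    have hb : b ≠ 0 := by
      intro hb
      rw [ha, hb] at hquad
      have hirr := minpoly.irreducible (Algebra.IsIntegral.isIntegral (R := k⟮x⟯) y)
      have hd := hirr.natDegree_pos
      rw [hquad] at hd
      simp at hd
    apply hy
    have hb' : (b : C.K) ≠ 0 := by simpa using hb
    have : y = -(c : C.K) / (b : C.K) := by
      rw [ha] at hroot
      rw [eq_div_iff hb']
      simp only [ZeroMemClass.coe_zero, zero_mul, zero_add] at hroot
      linear_combination hroot
    rw [this]
    exact div_mem (neg_mem c.2) b.2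
  have ha' : (a : C.K) ≠ 0 := by simpa using ha
  obtain ⟨U, V, -, hV, e⟩ := exists_coprime_of_mem_adjoin hx.transcendental
    (b ^ 2 - 4 * a * c : k⟮x⟯).2
  have hVx : aeval x V ≠ 0 := fun h0 => hV (transcendental_iff.1 hx.transcendental _ h0)
  -- Completing the square gives (2ay + b)² = b² − 4ac = U/V; multiplying by V² clears the
  -- denominator.
  refine ⟨U * V, (2 * a * y + b) * aeval x V, fun hmem => hy ?_, ?_⟩
  · have h4 : (2 * (a : C.K)) ∈ k⟮x⟯ := by
      have := mul_mem (IntermediateField.algebraMap_mem k⟮x⟯ (2 : k)) a.2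
      rwa [map_ofNat] at this
    have : y = ((2 * a * y + b) * aeval x V / aeval x V - b) / (2 * a) := by
      field_simp
      ring
    rw [this]
    exact div_mem (sub_mem (div_mem hmem (aeval_mem_adjoin x V)) b.2) h4
  · rw [map_mul, ← e]
    have : ((b ^ 2 - 4 * a * c : k⟮x⟯) : C.K) = (b : C.K) ^ 2 - 4 * a * c := by
      push_cast
      rfl
    rw [this]
    linear_combination 4 * (a : C.K) * (aeval x V) ^ 2 * hroot

/-- Among the equations w² = F(x) with w ∉ k(x), one with F of least degree has F squarefree. F is
not constant, because k is algebraically closed in the function field. -/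
theorem IsDegreeTwoMap.exists_model [PerfectField k] (h2 : (2 : k) ≠ 0) {x : C.K}
    (hx : C.IsDegreeTwoMap x) : ∃ g f y, IsHyperellipticModel (k := k) (K := C.K) g f x y := by
  classical
  have htr := hx.transcendental
  have hne : ∃ n, ∃ (F : k[X]) (w : C.K), w ∉ k⟮x⟯ ∧ w ^ 2 = aeval x F ∧ F.natDegree = n := by
    obtain ⟨F, w, h1, h3⟩ := hx.exists_sq_eq h2
    exact ⟨_, F, w, h1, h3, rfl⟩
  obtain ⟨F, w, hw, e, hF⟩ := Nat.find_spec hne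
  have hmin := fun m => Nat.find_min' hne (m := m)
  rw [← hF] at hmin
  have hw0 : w ≠ 0 := fun h0 => hw (h0 ▸ zero_mem _)
  have hF0 : F ≠ 0 := by
    rintro rfl
    exact hw0 (by simpa using e)
  have hsq : Squarefree F := by
    rintro p ⟨F', rfl⟩
    have hp : p ≠ 0 := left_ne_zero_of_mul (left_ne_zero_of_mul hF0)
    have hF' : F' ≠ 0 := right_ne_zero_of_mul hF0
    have hpx : aeval x p ≠ 0 := fun h0 => hp (transcendental_iff.1 htr _ h0)
    have := hmin _ ⟨F', w / aeval x p, fun hmem => hw ?_, ?_, rfl⟩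
    · rw [natDegree_mul (mul_ne_zero hp hp) hF', natDegree_mul hp hp] at this
      obtain ⟨c, rfl⟩ := natDegree_eq_zero.1 (by omega : p.natDegree = 0)
      exact isUnit_C.2 (isUnit_iff_ne_zero.2 (by simpa using hp))
    · have := mul_mem hmem (aeval_mem_adjoin x p)
      rwa [div_mul_cancel₀ _ hpx] at this
    · rw [div_pow, e]
      simp only [map_mul]
      field_simp
  have hpos : F.natDegree ≠ 0 := by
    intro h0
    obtain ⟨c, rfl⟩ := natDegree_eq_zero.1 h0
    have halg : IsAlgebraic k w := by
      refine ⟨X ^ 2 - Polynomial.C c, (monic_X_pow_sub_C c two_ne_zero).ne_zero, ?_⟩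
      simp [e]
    obtain ⟨d, rfl⟩ := C.constants w halg
    exact hw (IntermediateField.algebraMap_mem _ d)
  -- The degree is positive, so the rounded-down half of deg F − 1 is the g with deg F = 2g + 1 or
  -- 2g + 2.
  refine ⟨(F.natDegree - 1) / 2, F, w, h2, htr, e, ?_,
    PerfectField.separable_iff_squarefree.2 hsq, by omega, by omega⟩
  have hprime : (Module.finrank k⟮x⟯ C.K).Prime := by
    rw [show Module.finrank k⟮x⟯ C.K = 2 from hx]; exact Nat.prime_two
  have := IntermediateField.isSimpleOrder_of_finrank_prime k⟮x⟯ C.K hprime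
  have htop : k⟮x⟯⟮w⟯ = ⊤ := by
    refine (eq_bot_or_eq_top _).resolve_left fun hbot => hw ?_
    have := IntermediateField.mem_adjoin_simple_self k⟮x⟯ w
    rw [hbot, IntermediateField.mem_bot] at this
    obtain ⟨z, rfl⟩ := this
    exact z.2
  rw [← IntermediateField.adjoin_simple_adjoin_simple, htop, IntermediateField.restrictScalars_top]

variable {g : ℕ} {f : k[X]} {x y : C.K}

theorem isDegreeTwoMap_of_model (h : IsHyperellipticModel g f x y) : C.IsDegreeTwoMap x :=
  h.finrank_eq_two

variable [PerfectField k]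

theorem isHyperelliptic_of_model (h : IsHyperellipticModel g f x y) (hg : 2 ≤ g) :
    C.IsHyperelliptic :=
  ⟨by rwa [genus_eq h], x, isDegreeTwoMap_of_model h⟩

theorem mem_rationalWeierstrassPoints_iff (h : IsHyperellipticModel g f x y) (hg : 2 ≤ g)
    {P : ValuationSubring C.K} :
    P ∈ C.rationalWeierstrassPoints ↔ P ∈ C.rationalPoints ∧ C.IsRamifiedAt k⟮x⟯ P := by
  constructor
  · rintro ⟨hP, x', hx', hram⟩
    obtain ⟨g', f', y', h'⟩ := hx'.exists_model h.two_ne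
    rw [adjoin_eq_of_model (by rwa [genus_eq h]) h h']
    exact ⟨hP, hram⟩
  · rintro ⟨hP, hram⟩
    exact ⟨hP, x, isDegreeTwoMap_of_model h, hram⟩

/-- The points with x ∉ P are those with 1/x = 0 in the chart at infinity, where the reflected
polynomial takes the value `f.coeff (2 * g + 2)`. -/
theorem _root_.IsHyperellipticModel.encard_eq {K : Type*} [Field K] [Algebra k K] {x y : K}
    (h : IsHyperellipticModel g f x y)
    (Q : ValuationSubring K → Prop) (Q₁ Q₂ : k × k → Prop)
    (hQ₁ : ∀ P p, P.IsCenteredAt x y p → (Q P ↔ Q₁ p))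
    (hQ₂ : ∀ P p, P.IsCenteredAt x⁻¹ (y * x⁻¹ ^ (g + 1)) p → (Q P ↔ Q₂ p)) :
    {P : ValuationSubring K | ((P ≠ ⊤ ∧ ∀ c : k, algebraMap k K c ∈ P) ∧
      (∀ a ∈ P, ∃ c : k, P.valuation (a - algebraMap k K c) < 1)) ∧ Q P}.encard =
    {p : k × k | p.2 ^ 2 = f.eval p.1 ∧ Q₁ p}.encard +
      {b : k | b ^ 2 = f.coeff (2 * g + 2) ∧ Q₂ (0, b)}.encard := by
  have e1 := h.encard_affine Q Q₁ hQ₁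
  have e2 := h.inv.encard_affine (fun P => P.valuation x⁻¹ < 1 ∧ Q P) (fun p => p.1 = 0 ∧ Q₂ p) (by
    intro P p hp
    rw [hQ₂ P p hp]
    refine and_congr_left fun _ => ⟨fun h0 => ?_, fun h0 => ?_⟩
    · exact (ValuationSubring.eq_of_valuation_sub_lt hp.algebraMap_mem hp.lt_fst
        (by simpa using h0))
    · simpa [h0] using hp.lt_fst)
  have e3 : {p : k × k | p.2 ^ 2 = (f.reflect (2 * g + 2)).eval p.1 ∧ p.1 = 0 ∧ Q₂ p}.encard =
      {b : k | b ^ 2 = f.coeff (2 * g + 2) ∧ Q₂ (0, b)}.encard := by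
    have hc : (f.reflect (2 * g + 2)).eval 0 = f.coeff (2 * g + 2) := by
      rw [← coeff_zero_eq_eval_zero, coeff_reflect, revAt_le (by omega), Nat.sub_zero]
    rw [← (Prod.mk_right_injective (0 : k)).encard_image {b : k | _ ∧ _}]
    refine congrArg Set.encard (Set.ext fun ⟨a, b⟩ => ?_)
    simp only [Set.mem_ofPred_eq, Set.mem_image, Prod.mk.injEq]
    constructor
    · rintro ⟨h1, rfl, h3⟩
      exact ⟨b, ⟨by rw [h1, hc], h3⟩, rfl, rfl⟩
    · rintro ⟨b', ⟨h1, h3⟩, rfl, rfl⟩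
      exact ⟨by rw [h1, hc], rfl, h3⟩
  rw [← e1, ← e3, ← e2, ← Set.encard_union_eq]
  · refine congrArg Set.encard (Set.ext fun P => ?_)
    simp only [Set.mem_ofPred_eq, Set.mem_union]
    have hx : x ∈ P ∨ (x⁻¹ ∈ P ∧ P.valuation x⁻¹ < 1) := by
      by_cases hx : x ∈ P
      · exact Or.inl hx
      · have : P.valuation x⁻¹ < 1 := by
          rw [ValuationSubring.valuation_lt_one_iff_inv, inv_inv]; exact Or.inr hx
        exact Or.inr ⟨(P.valuation_le_one_iff _).1 this.le, this⟩
    tauto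
  · rw [Set.disjoint_left]
    rintro P ⟨-, -, hx, -⟩ ⟨-, -, -, hlt, -⟩
    rw [ValuationSubring.valuation_lt_one_iff_inv, inv_inv] at hlt
    rcases hlt with h0 | h0
    · exact h.inv.x_ne_zero h0
    · exact h0 hx

theorem encard_rationalPoints (h : IsHyperellipticModel g f x y) :
    C.rationalPoints.encard =
      {p : k × k | p.2 ^ 2 = f.eval p.1}.encard + {b : k | b ^ 2 = f.coeff (2 * g + 2)}.encard := by
  have := h.encard_eq (fun _ => True) (fun _ => True) (fun _ => True) (by simp) (by simp)
  simp only [and_true] at this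
  exact this

theorem encard_rationalWeierstrassPoints (h : IsHyperellipticModel g f x y) (hg : 2 ≤ g) :
    C.rationalWeierstrassPoints.encard =
      {a : k | f.eval a = 0}.encard + {b : k | b = 0 ∧ f.coeff (2 * g + 2) = 0}.encard := by
  have hx : k⟮x⁻¹⟯ = k⟮x⟯ := by
    apply le_antisymm <;> rw [IntermediateField.adjoin_simple_le_iff]
    · exact inv_mem (IntermediateField.mem_adjoin_simple_self _ _)
    · simpa using inv_mem (IntermediateField.mem_adjoin_simple_self k x⁻¹)
  have h1 := h.encard_eq (fun P => C.IsRamifiedAt k⟮x⟯ P) (fun p => p.2 = 0) (fun p => p.2 = 0)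
    (fun P p hp => h.ramified_iff hp) (fun P p hp => by rw [← hx]; exact h.inv.ramified_iff hp)
  have h2 : C.rationalWeierstrassPoints =
      {P | P ∈ C.rationalPoints ∧ C.IsRamifiedAt k⟮x⟯ P} := by
    ext P
    exact mem_rationalWeierstrassPoints_iff h hg
  have h3 : {p : k × k | p.2 ^ 2 = f.eval p.1 ∧ p.2 = 0}.encard = {a : k | f.eval a = 0}.encard := by
    rw [← (Prod.mk_left_injective (0 : k)).encard_image {a : k | f.eval a = 0}]
    refine congrArg Set.encard (Set.ext fun ⟨a, b⟩ => ?_)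
    simp only [Set.mem_ofPred_eq, Set.mem_image, Prod.mk.injEq]
    constructor
    · rintro ⟨h1, rfl⟩
      exact ⟨a, by rw [← h1]; simp, rfl, rfl⟩
    · rintro ⟨a, h1, rfl, rfl⟩
      exact ⟨by rw [h1]; simp, rfl⟩
  have h4 : {b : k | b ^ 2 = f.coeff (2 * g + 2) ∧ b = 0} =
      {b : k | b = 0 ∧ f.coeff (2 * g + 2) = 0} := by
    ext b
    simp only [Set.mem_ofPred_eq]
    constructor
    · rintro ⟨h1, rfl⟩
      exact ⟨rfl, by rw [← h1]; simp⟩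
    · rintro ⟨rfl, h1⟩
      exact ⟨by rw [h1]; simp, rfl⟩
  rw [← h3, ← h4, h2]
  exact h1

end SmoothProjCurve

/-! ### The double cover x = a + bz² -/

theorem Polynomial.eq_zero_of_mul_sq_eq_X_sub_C_mul_sq {k : Type*} [Field k] {G A B : k[X]} {a : k}
    (hG : G.eval a ≠ 0) (e : G * A ^ 2 = (X - C a) * B ^ 2) : B = 0 := by
  by_contra hB
  have hG0 : G ≠ 0 := by rintro rfl; simp at hG
  have hr : (X - C a) * B ^ 2 ≠ 0 := mul_ne_zero (X_sub_C_ne_zero a) (pow_ne_zero 2 hB)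
  have h1 := congrArg (rootMultiplicity a) e
  have hA : A ^ 2 ≠ 0 := right_ne_zero_of_mul (e ▸ hr)
  rw [rootMultiplicity_mul hr, rootMultiplicity_mul (e ▸ hr), rootMultiplicity_X_sub_C_self, sq,
    sq, rootMultiplicity_mul (sq A ▸ hA), rootMultiplicity_mul (mul_ne_zero hB hB),
    rootMultiplicity_eq_zero (p := G) (by exact hG)] at h1
  omega

/-- The derivative is 2bX · f′(a + bX²). Coprimality with X is f(a) ≠ 0, and with the other factor
it is inherited from f. -/
theorem Polynomial.Separable.comp_add_mul_sq {k : Type*} [Field k] (h2 : (2 : k) ≠ 0) {f : k[X]}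
    (hf : f.Separable) {a b : k} (hb : b ≠ 0) (ha : f.eval a ≠ 0) :
    (f.comp (C a + C b * X ^ 2)).Separable := by
  have hd : derivative (f.comp (C a + C b * X ^ 2)) =
      (C (b * 2) * X) * (derivative f).comp (C a + C b * X ^ 2) := by
    have h2 : C (2 : k) = 2 := map_ofNat C 2
    rw [derivative_comp, C_mul, h2]
    simp only [map_add, derivative_C, zero_add, derivative_C_mul,
      derivative_X_pow, Nat.cast_ofNat, h2, Nat.add_one_sub_one, pow_one]
    ring
  rw [Polynomial.Separable, hd]
  refine IsCoprime.mul_right (IsCoprime.mul_right ?_ ?_) ?_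
  · exact (isCoprime_one_right).of_isCoprime_of_dvd_right
      (isUnit_iff_dvd_one.1 (isUnit_C.2 (isUnit_iff_ne_zero.2 (mul_ne_zero hb h2))))
  · refine (irreducible_X.coprime_iff_not_dvd.2 fun h => ha ?_).symm
    rw [X_dvd_iff, coeff_zero_eq_eval_zero] at h
    simpa using h
  · obtain ⟨u, v, e⟩ := hf
    refine ⟨u.comp (C a + C b * X ^ 2), v.comp (C a + C b * X ^ 2), ?_⟩
    have := congrArg (fun p => p.comp (C a + C b * X ^ 2)) e
    simpa using this

theorem Polynomial.natDegree_comp_add_mul_sq {k : Type*} [Field k] (f : k[X]) (a : k) {b : k}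
    (hb : b ≠ 0) : (f.comp (C a + C b * X ^ 2)).natDegree = f.natDegree * 2 := by
  rw [natDegree_comp, natDegree_C_add, natDegree_C_mul_X_pow 2 b hb]

namespace IsHyperellipticModel

variable {k K : Type*} [Field k] [Field K] [Algebra k K] {g : ℕ} {f : k[X]} {x y : K}

/-- For s = (A + By)/D the y-part of s² is 2AB/D², so A or B is zero. Then bA² or bfB² equals (x −
a)D², and the multiplicities of the root a have opposite parity, since f(a) ≠ 0. -/
theorem sq_ne (h : IsHyperellipticModel g f x y) {a b : k} (hb : b ≠ 0) (ha : f.eval a ≠ 0)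
    (s : K) : s ^ 2 ≠ (x - algebraMap k K a) / algebraMap k K b := by
  intro e
  obtain ⟨A, B, D, hD, e1, -⟩ := h.exists_fraction s
  have hb' : algebraMap k K b ≠ 0 := by simpa using hb
  rw [eq_div_iff hb'] at e
  have key := h.poly_eq_zero (A := C b * A ^ 2 + C b * f * B ^ 2 - (X - C a) * D ^ 2)
    (B := C (b * 2) * (A * B)) (by
      simp only [map_sub, map_add, map_mul, map_pow, aeval_C, aeval_X, ← h.sq_eq, map_ofNat]
      linear_combination (-algebraMap k K b * (s * aeval x D + aeval x A + aeval x B * y)) * e1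
        + (aeval x D) ^ 2 * e)
  have hAB : A * B = 0 :=
    (mul_eq_zero.1 key.2).resolve_left (C_ne_zero.2 (mul_ne_zero hb h.two_ne))
  rcases mul_eq_zero.1 hAB with rfl | rfl
  · exact hD (eq_zero_of_mul_sq_eq_X_sub_C_mul_sq (G := C b * f) (A := B) (a := a)
      (by simp [hb, ha]) (by linear_combination key.1))
  · exact hD (eq_zero_of_mul_sq_eq_X_sub_C_mul_sq (G := C b) (A := A) (a := a)
      (by simp [hb]) (by linear_combination key.1))

/-- Adjoining a square root of `(x - a) / b` to the function field of `y ^ 2 = f(x)` gives the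
function field of `y ^ 2 = f(a + b * z ^ 2)`. -/
theorem of_sq_eq {L : Type*} [Field L] [Algebra k L] [Algebra K L] [IsScalarTower k K L]
    (h : IsHyperellipticModel g f x y) {g' : ℕ} (hg : f.natDegree = g' + 1) {a b : k} (hb : b ≠ 0)
    (ha : f.eval a ≠ 0) {z : L}
    (hz : algebraMap K L x = algebraMap k L a + algebraMap k L b * z ^ 2)
    (htop : Algebra.adjoin K {z} = ⊤) :
    IsHyperellipticModel g' (f.comp (C a + C b * X ^ 2)) z (algebraMap K L y) where
  two_ne := h.two_ne
  transcendental := by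
    intro halg
    have h1 : IsAlgebraic k (algebraMap K L x) := by
      rw [hz]
      exact (isAlgebraic_algebraMap a).add ((isAlgebraic_algebraMap b).mul (halg.pow 2))
    exact h.transcendental ((isAlgebraic_algebraMap_iff (algebraMap K L).injective).1 h1)
  sq_eq := by
    have : aeval z (C a + C b * X ^ 2) = algebraMap K L x := by simp [hz]
    rw [aeval_comp, this, aeval_algebraMap_apply, ← h.sq_eq, map_pow]
  adjoin_eq_top := by
    set M := k⟮z, algebraMap K L y⟯ with hM
    have hzM : z ∈ M := IntermediateField.subset_adjoin _ _ (Or.inl rfl)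
    have hyM : algebraMap K L y ∈ M := IntermediateField.subset_adjoin _ _ (Or.inr rfl)
    have hxM : algebraMap K L x ∈ M := by
      rw [hz]
      exact add_mem (M.algebraMap_mem a) (mul_mem (M.algebraMap_mem b) (pow_mem hzM 2))
    have hK : ∀ c : K, algebraMap K L c ∈ M := by
      intro c
      have hle : k⟮x, y⟯ ≤ M.comap (IsScalarTower.toAlgHom k K L) := by
        rw [IntermediateField.adjoin_le_iff]
        rintro c (rfl | rfl)
        · exact hxM
        · exact hyM
      rw [h.adjoin_eq_top] at hle
      exact hle (IntermediateField.mem_top (x := c))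
    rw [eq_top_iff]
    intro c _
    have hc : c ∈ Algebra.adjoin K {z} := htop ▸ Algebra.mem_top
    induction hc using Algebra.adjoin_induction with
    | mem c hc => rw [Set.mem_singleton_iff.1 hc]; exact hzM
    | algebraMap c => exact hK c
    | add c d _ _ hc hd => exact add_mem (hc trivial) (hd trivial)
    | mul c d _ _ hc hd => exact mul_mem (hc trivial) (hd trivial)
  separable := h.separable.comp_add_mul_sq h.two_ne hb ha
  le_natDegree := by rw [natDegree_comp_add_mul_sq f a hb]; omega
  natDegree_le := by rw [natDegree_comp_add_mul_sq f a hb]; omega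

end IsHyperellipticModel

namespace SmoothProjCurve

variable {k : Type u} [Field k] {C : SmoothProjCurve.{u, v} k} {g : ℕ} {f : k[X]} {x y : C.K}

/-- By `sq_ne`, adjoining the square root gives a field of degree two over the function field of
`C`. That k is algebraically closed in it is read off from its own model. -/
theorem exists_doubleCover (h : IsHyperellipticModel g f x y) {g' : ℕ}
    (hg : f.natDegree = g' + 1) {a b : k} (hb : b ≠ 0) (ha : f.eval a ≠ 0) :
    ∃ D : SmoothProjCurve.{u, v} k, D.IsDoubleCoverOf C ∧ ∃ z w : D.K,
      IsHyperellipticModel g' (f.comp (Polynomial.C a + Polynomial.C b * X ^ 2)) z w := by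
  set c : C.K := (x - algebraMap k C.K a) / algebraMap k C.K b with hc
  set p : C.K[X] := X ^ 2 - Polynomial.C c with hp
  have hirr : Irreducible p := by
    rw [hp, X_pow_sub_C_irreducible_iff_of_prime Nat.prime_two]
    exact h.sq_ne hb ha
  have : Fact (Irreducible p) := ⟨hirr⟩
  have hb' : algebraMap k C.K b ≠ 0 := by simpa using hb
  have hmodel : IsHyperellipticModel g' (f.comp (Polynomial.C a + Polynomial.C b * X ^ 2))
      (AdjoinRoot.root p) (algebraMap C.K (AdjoinRoot p) y) := by
    refine h.of_sq_eq hg hb ha ?_ (AdjoinRoot.adjoinRoot_eq_top)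
    have h1 := AdjoinRoot.eval₂_root p
    rw [hp, eval₂_sub, eval₂_pow, eval₂_X, eval₂_C, sub_eq_zero] at h1
    rw [h1]
    have h2 : x = algebraMap k C.K a + algebraMap k C.K b * c := by
      rw [hc]; field_simp; ring
    rw [IsScalarTower.algebraMap_apply k C.K (AdjoinRoot p),
      IsScalarTower.algebraMap_apply k C.K (AdjoinRoot p), AdjoinRoot.algebraMap_eq, ← map_mul,
      ← map_add, ← h2]
  have hfin := hmodel.finiteDimensional
  let D : SmoothProjCurve.{u, v} k :=
    { K := AdjoinRoot p
      exists_finite := ⟨_, hmodel.transcendental, hfin⟩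
      constants := fun a ha => hmodel.mem_range_of_isAlgebraic ha }
  refine ⟨D, ⟨IsScalarTower.toAlgHom k C.K (AdjoinRoot p), ?_⟩, _, _, hmodel⟩
  have hrank : Module.finrank C.K (AdjoinRoot p) = 2 := by
    rw [(AdjoinRoot.powerBasis hirr.ne_zero).finrank, AdjoinRoot.powerBasis_dim, hp,
      natDegree_X_pow_sub_C]
  rw [← hrank]
  symm
  exact Algebra.finrank_eq_of_equiv_equiv
    (AlgEquiv.ofInjectiveField (IsScalarTower.toAlgHom k C.K (AdjoinRoot p))).toRingEquiv
    (RingEquiv.refl _) (by ext; rfl)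

end SmoothProjCurve

/-! ### Point counts over a finite field -/

section Counting

variable {k : Type*} [Field k]

theorem ringChar_ne_two (h2 : (2 : k) ≠ 0) : ringChar k ≠ 2 := by
  intro h
  apply h2
  have := ringChar.Nat.cast_ringChar (R := k)
  rw [h] at this
  exact_mod_cast this

theorem coeff_comp_add_mul_sq (f : k[X]) (a : k) {b : k} (hb : b ≠ 0) :
    (f.comp (C a + C b * X ^ 2)).coeff (f.natDegree * 2) = f.leadingCoeff * b ^ f.natDegree := by
  rw [← natDegree_comp_add_mul_sq f a hb, coeff_natDegree, leadingCoeff_comp]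
  · congr 2
    rw [leadingCoeff, natDegree_C_add, natDegree_C_mul_X_pow 2 b hb]
    simp
  · rw [natDegree_C_add, natDegree_C_mul_X_pow 2 b hb]; norm_num

variable [Fintype k] [DecidableEq k]

/-- The number of rational points of the smooth model of `y ^ 2 = f(x)`, where `n` is the degree of
the binary form attached to `f`. -/
def pointCount (f : k[X]) (n : ℕ) : ℤ :=
  ∑ a : k, (quadraticChar k (f.eval a) + 1) + (quadraticChar k (f.coeff n) + 1)

theorem card_filter_sq_eq (h2 : (2 : k) ≠ 0) (a : k) :
    ((Finset.univ.filter fun b : k => b ^ 2 = a).card : ℤ) = quadraticChar k a + 1 := by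
  rw [← quadraticChar_card_sqrts (ringChar_ne_two h2)]
  congr 2
  ext b
  simp

theorem encard_eq_card_filter {α : Type*} [Fintype α] (p : α → Prop) [DecidablePred p] :
    {a | p a}.encard = ((Finset.univ.filter p).card : ℕ∞) := by
  rw [← Set.encard_coe_eq_coe_finsetCard]
  congr 1
  ext a
  simp

theorem exists_encard_eq_pointCount (h2 : (2 : k) ≠ 0) (f : k[X]) (n : ℕ) :
    ∃ N : ℕ, {p : k × k | p.2 ^ 2 = f.eval p.1}.encard + {b : k | b ^ 2 = f.coeff n}.encard = N ∧
      (N : ℤ) = pointCount f n := by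
  refine ⟨(Finset.univ.filter fun p : k × k => p.2 ^ 2 = f.eval p.1).card +
    (Finset.univ.filter fun b : k => b ^ 2 = f.coeff n).card, ?_, ?_⟩
  · rw [encard_eq_card_filter, encard_eq_card_filter]
    push_cast
    rfl
  · rw [pointCount, Nat.cast_add, card_filter_sq_eq h2]
    congr 1
    rw [Finset.card_filter, Fintype.sum_prod_type]
    push_cast
    refine Finset.sum_congr rfl fun a _ => ?_
    rw [← card_filter_sq_eq h2, Finset.card_filter]
    push_cast
    rfl

theorem quadraticChar_sq {a : k} (ha : a ≠ 0) :
    quadraticChar k a * quadraticChar k a = 1 := by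
  have := quadraticChar_sq_one ha
  rwa [sq] at this

theorem quadraticChar_div (a : k) {b : k} (hb : b ≠ 0) :
    quadraticChar k (a / b) = quadraticChar k b * quadraticChar k a := by
  have h1 : a = a / b * b := by field_simp
  conv_rhs => rw [h1]
  rw [map_mul (quadraticChar k) (a / b) b]
  linear_combination (-quadraticChar k (a / b)) * quadraticChar_sq hb

/-- The fibre of z ↦ a + bz² over x has 1 + χ((x − a)/b) elements, and χ(1/b) = χ(b). -/
theorem sum_comp_add_mul_sq (h2 : (2 : k) ≠ 0) (G : k → ℤ) (a : k) {b : k} (hb : b ≠ 0) :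
    ∑ z : k, G (a + b * z ^ 2) =
      ∑ x : k, (1 + quadraticChar k b * quadraticChar k (x - a)) * G x := by
  rw [← Finset.sum_fiberwise (s := Finset.univ) (g := fun z : k => a + b * z ^ 2)]
  refine Finset.sum_congr rfl fun x _ => ?_
  have h1 : ∑ z ∈ Finset.univ.filter (fun z : k => a + b * z ^ 2 = x), G (a + b * z ^ 2) =
      ∑ z ∈ Finset.univ.filter (fun z : k => a + b * z ^ 2 = x), G x :=
    Finset.sum_congr rfl fun z hz => by rw [(Finset.mem_filter.1 hz).2]
  rw [h1, Finset.sum_const, nsmul_eq_mul]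
  congr 1
  rw [← quadraticChar_div _ hb, add_comm, ← card_filter_sq_eq h2]
  congr 2
  ext z
  simp only [Finset.mem_filter, Finset.mem_univ, true_and]
  rw [eq_div_iff hb]
  constructor <;> intro h <;> linear_combination h

theorem pointCount_comp (h2 : (2 : k) ≠ 0) (f : k[X]) {n : ℕ} (hn : n = f.natDegree * 2) (a : k)
    {b : k} (hb : b ≠ 0) :
    pointCount (f.comp (C a + C b * X ^ 2)) n =
      ∑ x : k, (1 + quadraticChar k b * quadraticChar k (x - a)) *
        (quadraticChar k (f.eval x) + 1) +
      (quadraticChar k (f.leadingCoeff * b ^ f.natDegree) + 1) := by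
  rw [pointCount, hn, coeff_comp_add_mul_sq f a hb,
    ← sum_comp_add_mul_sq h2 (fun x => quadraticChar k (f.eval x) + 1) a hb]
  simp [eval_comp]

theorem encard_roots_comp (h2 : (2 : k) ≠ 0) (f : k[X]) (a : k) {b : k} (hb : b ≠ 0) :
    ∃ N : ℕ, {z : k | (f.comp (C a + C b * X ^ 2)).eval z = 0}.encard = N ∧
      (N : ℤ) = ∑ x ∈ Finset.univ.filter (fun x : k => f.eval x = 0),
        (1 + quadraticChar k b * quadraticChar k (x - a)) := by
  refine ⟨_, encard_eq_card_filter _, ?_⟩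
  have := sum_comp_add_mul_sq h2 (fun x => if f.eval x = 0 then 1 else 0) a hb
  rw [Finset.sum_filter, Finset.card_filter]
  push_cast
  simpa [eval_comp] using this

/-- The two quadratic twists of the double cover ramified over `0` and `∞` together have twice as
many points as the base. -/
theorem pointCount_twist_add (h2 : (2 : k) ≠ 0) {f : k[X]} {g n : ℕ} (hf : f.natDegree = 2 * g + 2)
    (hn : n = f.natDegree * 2) {c : k} (hc : quadraticChar k c = -1) :
    pointCount (f.comp (C 0 + C 1 * X ^ 2)) n + pointCount (f.comp (C 0 + C c * X ^ 2)) n =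
      2 * pointCount f (2 * g + 2) := by
  have hc0 : c ≠ 0 := by rintro rfl; simp at hc
  -- The degree of f is even, so b^(deg f) is a square and both twists have the same number of
  -- points at infinity as the base.
  have hlc : ∀ b : k, b ≠ 0 → quadraticChar k (f.leadingCoeff * b ^ f.natDegree) =
      quadraticChar k (f.coeff (2 * g + 2)) := by
    intro b hb
    rw [map_mul, map_pow, hf, show 2 * g + 2 = (g + 1) * 2 by ring, pow_mul, ← map_pow,
      quadraticChar_sq_one (pow_ne_zero _ hb), mul_one, leadingCoeff, hf]
    ring_nf
  rw [pointCount_comp h2 f hn 0 one_ne_zero, pointCount_comp h2 f hn 0 hc0, hlc 1 one_ne_zero,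
    hlc c hc0, hc, map_one, pointCount]
  have : ∑ x : k, (1 + 1 * quadraticChar k (x - 0)) * (quadraticChar k (f.eval x) + 1) +
      ∑ x : k, (1 + -1 * quadraticChar k (x - 0)) * (quadraticChar k (f.eval x) + 1) =
      2 * ∑ x : k, (quadraticChar k (f.eval x) + 1) := by
    rw [← Finset.sum_add_distrib, Finset.mul_sum]
    exact Finset.sum_congr rfl fun x _ => by ring
  linear_combination this

/-- The summand is χ(1 − x/a), and t = x/a runs over the nonzero elements. The sum of χ(1 − t) over
all t is 0, and t = 0 contributes 1. -/
theorem sum_quadraticChar_mul_sub (h2 : (2 : k) ≠ 0) {x : k} (hx : x ≠ 0) :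
    ∑ a ∈ Finset.univ.erase (0 : k), quadraticChar k (-a) * quadraticChar k (x - a) = -1 := by
  have h1 : ∑ a ∈ Finset.univ.erase (0 : k), quadraticChar k (-a) * quadraticChar k (x - a) =
      ∑ t ∈ Finset.univ.erase (0 : k), quadraticChar k (1 - t) := by
    refine Finset.sum_nbij' (fun a => x / a) (fun t => x / t) ?_ ?_ ?_ ?_ ?_
    · intro a ha; simp_all
    · intro a ha; simp_all
    · intro a ha; simp_all
    · intro a ha; simp_all
    · intro a ha
      have ha0 : a ≠ 0 := Finset.ne_of_mem_erase ha
      rw [← quadraticChar_div _ (neg_ne_zero.2 ha0)]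
      congr 1
      field_simp
      ring
  have h3 : ∑ t : k, quadraticChar k (1 - t) = 0 := by
    rw [← quadraticChar_sum_zero (ringChar_ne_two h2)]
    exact (Equiv.subLeft (1 : k)).sum_comp (quadraticChar k)
  rw [← Finset.add_sum_erase _ _ (Finset.mem_univ (0 : k)), sub_zero, map_one] at h3
  rw [h1]
  linear_combination h3

theorem sum_quadraticChar_leading (h2 : (2 : k) ≠ 0) (c : k) (g : ℕ) :
    ∑ a ∈ Finset.univ.erase (0 : k), quadraticChar k (c * (-a) ^ (2 * g + 1)) = 0 := by
  have h1 : ∀ a ∈ Finset.univ.erase (0 : k),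
      quadraticChar k (c * (-a) ^ (2 * g + 1)) = quadraticChar k c * quadraticChar k (-a) := by
    intro a ha
    have ha0 : -a ≠ 0 := neg_ne_zero.2 (Finset.ne_of_mem_erase ha)
    rw [map_mul, pow_succ, mul_comm 2 g, pow_mul, map_mul, quadraticChar_sq_one' (pow_ne_zero _ ha0),
      one_mul]
  rw [Finset.sum_congr rfl h1, ← Finset.mul_sum]
  have h3 : ∑ a : k, quadraticChar k (-a) = 0 := by
    rw [← quadraticChar_sum_zero (ringChar_ne_two h2)]
    exact Fintype.sum_equiv (Equiv.neg k) _ _ fun _ => rfl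
  rw [← Finset.add_sum_erase _ _ (Finset.mem_univ (0 : k)), neg_zero, quadraticChar_zero,
    zero_add] at h3
  rw [h3, mul_zero]

theorem two_dvd_quadraticChar_add_one {a : k} (ha : a ≠ 0) : (2 : ℤ) ∣ quadraticChar k a + 1 := by
  rcases quadraticChar_dichotomy ha with h | h <;> rw [h] <;> norm_num

/-- Among the double covers that ramify over `∞` and a point `a ≠ 0`, and split over `0`, one has
at least as many points as the base. -/
theorem exists_pointCount_le (h2 : (2 : k) ≠ 0) {f : k[X]} {g n : ℕ} (hf : f.natDegree = 2 * g + 1)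
    (hn : n = f.natDegree * 2) (h0 : ∀ a, f.eval a = 0 ↔ a = 0) :
    ∃ a : k, a ≠ 0 ∧
      pointCount f (2 * g + 2) ≤ pointCount (f.comp (C a + C (-a) * X ^ 2)) n := by
  by_contra! hcon
  set T : k → ℤ := fun x => quadraticChar k (f.eval x) + 1 with hT
  set S : ℤ := ∑ x ∈ Finset.univ.erase (0 : k), T x with hS
  have hf0 : f ≠ 0 := by rintro rfl; simp at hf
  have hT0 : T 0 = 1 := by simp [hT, (h0 0).2 rfl]
  have hNf : pointCount f (2 * g + 2) = S + 2 := by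
    rw [pointCount, coeff_eq_zero_of_natDegree_lt (by omega), quadraticChar_zero,
      ← Finset.add_sum_erase _ _ (Finset.mem_univ (0 : k))]
    change T 0 + S + (0 + 1) = S + 2
    rw [hT0]
    ring
  have hTdvd : ∀ x ∈ Finset.univ.erase (0 : k), (2 : ℤ) ∣ T x := fun x hx =>
    two_dvd_quadraticChar_add_one fun h => Finset.ne_of_mem_erase hx ((h0 x).1 h)
  have hTle : ∀ x ∈ Finset.univ.erase (0 : k), T x ≤ 2 := fun x hx => by
    rcases quadraticChar_dichotomy
      (fun h => Finset.ne_of_mem_erase hx ((h0 x).1 h) : f.eval x ≠ 0) with h | h <;>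
    (simp only [hT]; rw [h]; norm_num)
  have hSdvd : (2 : ℤ) ∣ S := Finset.dvd_sum hTdvd
  have hN : ∀ a ∈ Finset.univ.erase (0 : k), pointCount (f.comp (C a + C (-a) * X ^ 2)) n =
      2 + ∑ x ∈ Finset.univ.erase (0 : k),
        (1 + quadraticChar k (-a) * quadraticChar k (x - a)) * T x +
        (quadraticChar k (f.leadingCoeff * (-a) ^ (2 * g + 1)) + 1) := by
    intro a ha
    have ha0 : -a ≠ 0 := neg_ne_zero.2 (Finset.ne_of_mem_erase ha)
    rw [pointCount_comp h2 f hn a ha0, hf, ← Finset.add_sum_erase _ _ (Finset.mem_univ (0 : k)),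
      zero_sub, quadraticChar_sq ha0]
    change (1 + 1) * T 0 + _ + _ = _
    rw [hT0]
    rfl
  -- Both S + 2 and the count on the cover are even, so a count below S + 2 is at most S.
  have hle : ∀ a ∈ Finset.univ.erase (0 : k),
      pointCount (f.comp (C a + C (-a) * X ^ 2)) n ≤ S := by
    intro a ha
    have ha0 := Finset.ne_of_mem_erase ha
    have hlt := hcon a ha0
    rw [hNf] at hlt
    have hdvd : (2 : ℤ) ∣ pointCount (f.comp (C a + C (-a) * X ^ 2)) n := by
      rw [hN a ha]
      refine dvd_add (dvd_add (dvd_refl _) (Finset.dvd_sum fun x hx => ?_))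
        (two_dvd_quadraticChar_add_one ?_)
      · exact (hTdvd x hx).mul_left _
      · exact mul_ne_zero (leadingCoeff_ne_zero.2 hf0) (pow_ne_zero _ (neg_ne_zero.2 ha0))
    omega
  -- With m = q − 1, summation over a ≠ 0 gives 3m + (m − 1)S ≤ mS, that is 3m ≤ S, while S ≤ 2m.
  have hsum := Finset.sum_le_sum hle
  rw [Finset.sum_congr rfl hN, Finset.sum_add_distrib, Finset.sum_add_distrib, Finset.sum_comm,
    Finset.sum_add_distrib, sum_quadraticChar_leading h2] at hsum
  have hinner : ∀ x ∈ Finset.univ.erase (0 : k), ∑ a ∈ Finset.univ.erase (0 : k),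
      (1 + quadraticChar k (-a) * quadraticChar k (x - a)) * T x =
      ((Finset.univ.erase (0 : k)).card - 1 : ℤ) * T x := by
    intro x hx
    rw [← Finset.sum_mul, Finset.sum_add_distrib,
      sum_quadraticChar_mul_sub h2 (Finset.ne_of_mem_erase hx)]
    simp only [Finset.sum_const, nsmul_eq_mul, mul_one]
    ring
  rw [Finset.sum_congr rfl hinner, ← Finset.mul_sum, ← hS] at hsum
  simp only [Finset.sum_const, nsmul_eq_mul, mul_one] at hsum
  have hSle := Finset.sum_le_card_nsmul _ _ _ hTle
  rw [nsmul_eq_mul, ← hS] at hSle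
  have hcard : 0 < (Finset.univ.erase (0 : k)).card :=
    Finset.card_pos.2 ⟨1, by simp⟩
  have hcard' : (0 : ℤ) < (Finset.univ.erase (0 : k)).card := by exact_mod_cast hcard
  generalize ((Finset.univ.erase (0 : k)).card : ℤ) = m at *
  linarith

end Counting

/-! ### Placing the branch points -/

theorem two_ne_zero_of_odd_card {k : Type*} [Field k] [Finite k] (h : Odd (Nat.card k)) :
    (2 : k) ≠ 0 := by
  intro h2
  have := Fintype.ofFinite k
  have h1 := CharP.ringChar_of_prime_eq_zero (R := k) Nat.prime_two (by exact_mod_cast h2)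
  have h3 := FiniteField.even_card_iff_char_two.1 h1
  rw [← Nat.card_eq_fintype_card] at h3
  have := Nat.odd_iff.1 h
  omega

theorem Polynomial.eval_inv_reflect_eq_zero_iff {k : Type*} [Field k] {f : k[X]} {N : ℕ}
    (hf : f.natDegree ≤ N) {a : k} (ha : a ≠ 0) :
    (f.reflect N).eval a = 0 ↔ f.eval a⁻¹ = 0 := by
  have := aeval_inv_reflect_mul_pow (inv_ne_zero ha) hf
  rw [inv_inv, coe_aeval_eq_eval, coe_aeval_eq_eval] at this
  rw [← this]
  simp [ha]

namespace IsHyperellipticModel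

variable {k K : Type*} [Field k] [Field K] [Algebra k K] {g : ℕ} {f : k[X]} {x y : K}

theorem coeff_eq_zero_iff (h : IsHyperellipticModel g f x y) :
    f.coeff (2 * g + 2) = 0 ↔ f.natDegree = 2 * g + 1 := by
  have h1 := h.le_natDegree
  have h2 := h.natDegree_le
  constructor
  · intro h0
    by_contra hne
    have : f.natDegree = 2 * g + 2 := by omega
    rw [← this, coeff_natDegree, leadingCoeff_eq_zero] at h0
    exact h.ne_zero h0
  · intro h0
    exact coeff_eq_zero_of_natDegree_lt (by omega)

theorem natDegree_inv_eq_iff [PerfectField k] (h : IsHyperellipticModel g f x y) :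
    (f.reflect (2 * g + 2)).natDegree = 2 * g + 1 ↔ f.eval 0 = 0 := by
  rw [← h.inv.coeff_eq_zero_iff, coeff_reflect, revAt_le le_rfl, Nat.sub_self,
    coeff_zero_eq_eval_zero]

theorem natDegree_comp_X_add_C (f : k[X]) (c : k) : (f.comp (X + C c)).natDegree = f.natDegree := by
  simp [natDegree_comp]

theorem natDegree_eq_or (h : IsHyperellipticModel g f x y) :
    f.natDegree = 2 * g + 1 ∨ f.natDegree = 2 * g + 2 := by
  have h1 := h.le_natDegree
  have h2 := h.natDegree_le
  omega

/-- Two branch points `∞`, `0` can be moved to points whose ratio is a prescribed constant. -/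
theorem exists_of_ratio [PerfectField k] (h : IsHyperellipticModel g f x y)
    (hdeg : f.natDegree = 2 * g + 1) (h0 : ∀ a, f.eval a = 0 ↔ a = 0) {n : k}
    (hn1 : n ≠ 1) : ∃ (F : k[X]) (z w : K), IsHyperellipticModel g F z w ∧
      F.natDegree = 2 * g + 2 ∧ ∃ s : k, s ≠ 0 ∧ ∀ a, F.eval a = 0 ↔ a = s ∨ a = n * s := by
  -- The branch points ∞, 0 become ∞, −1 and, after inversion, 0, −1. Translation by t = 1/(n − 1)
  -- makes them −t and −1 − t, whose ratio is n.
  have hm1 := h.translate 1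
  have hm2 := hm1.inv
  have hn1' : n - 1 ≠ 0 := sub_ne_zero.2 hn1
  set f₁ := f.comp (X + C 1) with hf₁
  set f₂ := f₁.reflect (2 * g + 2) with hf₂
  have e1 : ∀ a, f₁.eval a = 0 ↔ a = -1 := by
    intro a
    rw [hf₁, eval_comp]
    simp [h0, add_eq_zero_iff_eq_neg]
  have e2 : ∀ a, f₂.eval a = 0 ↔ a = 0 ∨ a = -1 := by
    intro a
    by_cases ha : a = 0
    · subst ha
      have : f₁.natDegree = 2 * g + 1 := by rw [hf₁, natDegree_comp_X_add_C, hdeg]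
      simp only [true_or, iff_true]
      rw [← coeff_zero_eq_eval_zero, hf₂, coeff_reflect, revAt_le (by omega), Nat.sub_zero,
        hm1.coeff_eq_zero_iff, this]
    · rw [hf₂, eval_inv_reflect_eq_zero_iff hm1.natDegree_le ha, e1]
      simp only [ha, false_or]
      rw [inv_eq_iff_eq_inv, inv_neg, inv_one]
  have hd2 : f₂.natDegree = 2 * g + 2 := by
    refine hm2.natDegree_eq_or.resolve_left fun hd => ?_
    have := hm1.natDegree_inv_eq_iff.1 hd
    rw [e1] at this
    exact one_ne_zero (by linear_combination this)
  refine ⟨_, _, _, hm2.translate (1 / (n - 1)), by rw [natDegree_comp_X_add_C, hd2],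
    -(1 / (n - 1)), neg_ne_zero.2 (one_div_ne_zero hn1'), fun a => ?_⟩
  rw [eval_comp, eval_add, eval_X, eval_C, e2]
  have e3 : n * -(1 / (n - 1)) = -1 - 1 / (n - 1) := by field_simp; ring
  rw [e3]
  constructor <;> rintro (e | e)
  · left; linear_combination e
  · right; linear_combination e
  · left; linear_combination e
  · right; linear_combination e

end IsHyperellipticModel

namespace SmoothProjCurve

variable {k : Type u} [Field k] [Fintype k] [DecidableEq k] {C D : SmoothProjCurve.{u, v} k}
  {g g' : ℕ} {f F : k[X]}

theorem encard_rationalPoints_le {x y : C.K} {z w : D.K} (h : IsHyperellipticModel g f x y)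
    (h' : IsHyperellipticModel g' F z w)
    (hle : pointCount f (2 * g + 2) ≤ pointCount F (2 * g' + 2)) :
    C.rationalPoints.encard ≤ D.rationalPoints.encard := by
  obtain ⟨N, hN, hN'⟩ := exists_encard_eq_pointCount h.two_ne f (2 * g + 2)
  obtain ⟨M, hM, hM'⟩ := exists_encard_eq_pointCount h.two_ne F (2 * g' + 2)
  rw [encard_rationalPoints h, encard_rationalPoints h', hN, hM]
  rw [← hN', ← hM'] at hle
  exact_mod_cast hle

theorem encard_weierstrass_of_natDegree {x y : C.K} (h : IsHyperellipticModel g f x y)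
    (hg : 2 ≤ g) (hf : f.natDegree = 2 * g + 2) :
    C.rationalWeierstrassPoints.encard =
      ((Finset.univ.filter fun a : k => f.eval a = 0).card : ℕ∞) := by
  have : f.coeff (2 * g + 2) ≠ 0 := fun h0 => by
    have := h.coeff_eq_zero_iff.1 h0
    omega
  rw [encard_rationalWeierstrassPoints h hg, encard_eq_card_filter]
  simp [this]

theorem encard_weierstrass_of_natDegree_odd {x y : C.K} (h : IsHyperellipticModel g f x y)
    (hg : 2 ≤ g) (hf : f.natDegree = 2 * g + 1) :
    C.rationalWeierstrassPoints.encard =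
      ((Finset.univ.filter fun a : k => f.eval a = 0).card + 1 : ℕ) := by
  have : f.coeff (2 * g + 2) = 0 := h.coeff_eq_zero_iff.2 hf
  rw [encard_rationalWeierstrassPoints h hg, encard_eq_card_filter]
  simp [this]

theorem exists_eval_ne_zero (h : (Finset.univ.filter fun a : k => f.eval a = 0).card <
    Fintype.card k) : ∃ a, f.eval a ≠ 0 := by
  by_contra! hall
  rw [Finset.filter_true_of_mem (fun a _ => hall a), Finset.card_univ] at h
  exact lt_irrefl _ h

/-- A rational point that is not a branch point is moved to ∞ by inversion if necessary. The
Weierstrass count, recomputed in the new model, leaves a second one to translate to 0. -/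
theorem exists_model_even {x y : C.K} (h : IsHyperellipticModel g f x y) (hg : 2 ≤ g)
    (hW : C.rationalWeierstrassPoints.encard < (Fintype.card k : ℕ∞)) :
    ∃ (F : k[X]) (z w : C.K), IsHyperellipticModel g F z w ∧ F.natDegree = 2 * g + 2 ∧
      F.eval 0 ≠ 0 := by
  have key : ∀ {f : k[X]} {x y : C.K}, IsHyperellipticModel g f x y → f.natDegree = 2 * g + 2 →
      ∃ (F : k[X]) (z w : C.K), IsHyperellipticModel g F z w ∧ F.natDegree = 2 * g + 2 ∧
        F.eval 0 ≠ 0 := by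
    intro f x y h hf
    rw [encard_weierstrass_of_natDegree h hg hf] at hW
    obtain ⟨a, ha⟩ := exists_eval_ne_zero (by exact_mod_cast hW)
    exact ⟨_, _, _, h.translate a, by rw [IsHyperellipticModel.natDegree_comp_X_add_C, hf],
      by simpa [eval_comp] using ha⟩
  rcases h.natDegree_eq_or with hf | hf
  · have hW' := hW
    rw [encard_weierstrass_of_natDegree_odd h hg hf] at hW'
    have hlt : (Finset.univ.filter fun a : k => f.eval a = 0).card + 1 < Fintype.card k := by
      exact_mod_cast hW'
    obtain ⟨a, ha⟩ := exists_eval_ne_zero (f := f) (by omega)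
    refine key (h.translate a).inv ((h.translate a).inv.natDegree_eq_or.resolve_left fun hd => ?_)
    have := (h.translate a).natDegree_inv_eq_iff.1 hd
    exact ha (by simpa [eval_comp] using this)
  · exact key h hf

/-- If ∞ is not a branch point, a root of f is translated to 0 and inverted to ∞. The count then
leaves a single root, which is translated to 0. -/
theorem exists_model_odd {x y : C.K} (h : IsHyperellipticModel g f x y) (hg : 2 ≤ g)
    (hW : C.rationalWeierstrassPoints.encard = 2) :
    ∃ (F : k[X]) (z w : C.K), IsHyperellipticModel g F z w ∧ F.natDegree = 2 * g + 1 ∧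
      ∀ a, F.eval a = 0 ↔ a = 0 := by
  have key : ∀ {f : k[X]} {x y : C.K}, IsHyperellipticModel g f x y → f.natDegree = 2 * g + 1 →
      ∃ (F : k[X]) (z w : C.K), IsHyperellipticModel g F z w ∧ F.natDegree = 2 * g + 1 ∧
        ∀ a, F.eval a = 0 ↔ a = 0 := by
    intro f x y h hf
    rw [encard_weierstrass_of_natDegree_odd h hg hf] at hW
    have hcard : (Finset.univ.filter fun a : k => f.eval a = 0).card + 1 = 2 := by
      exact_mod_cast hW
    obtain ⟨a, ha⟩ := Finset.card_eq_one.1 (Nat.succ_injective hcard)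
    refine ⟨_, _, _, h.translate a, by rw [IsHyperellipticModel.natDegree_comp_X_add_C, hf],
      fun b => ?_⟩
    have := Finset.ext_iff.1 ha (b + a)
    simpa [eval_comp] using this
  rcases h.natDegree_eq_or with hf | hf
  · exact key h hf
  · have hW' := hW
    rw [encard_weierstrass_of_natDegree h hg hf] at hW'
    have hcard : (Finset.univ.filter fun a : k => f.eval a = 0).card = 2 := by
      exact_mod_cast hW'
    obtain ⟨a, ha⟩ := Finset.card_pos.1 (by omega :
      0 < (Finset.univ.filter fun a : k => f.eval a = 0).card)
    refine key (h.translate a).inv ((h.translate a).natDegree_inv_eq_iff.2 ?_)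
    simpa [eval_comp] using ha

theorem encard_weierstrass_comp {z w : D.K} {a b : k} (hb : b ≠ 0) (hg : 2 ≤ g)
    (hf : f.natDegree = g + 1)
    (h : IsHyperellipticModel g (f.comp (Polynomial.C a + Polynomial.C b * X ^ 2)) z w)
    (hsum : ∑ x ∈ Finset.univ.filter (fun x : k => f.eval x = 0),
        (1 + quadraticChar k b * quadraticChar k (x - a)) = 2) :
    D.rationalWeierstrassPoints.encard = 2 := by
  obtain ⟨N, hN, hN'⟩ := encard_roots_comp h.two_ne f a hb
  rw [encard_weierstrass_of_natDegree h hg (by rw [natDegree_comp_add_mul_sq f a hb]; omega),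
    ← encard_eq_card_filter, hN]
  have : N = 2 := by
    rw [hsum] at hN'
    exact_mod_cast hN'
  rw [this]
  rfl

theorem exists_doubleCover_even (hg : 2 ≤ g) {x y : C.K} (h : IsHyperellipticModel g f x y)
    (hdeg : f.natDegree = 2 * g + 2) (h0 : f.eval 0 ≠ 0) :
    ∃ D : SmoothProjCurve.{u, v} k, D.IsHyperelliptic ∧ D.genus = 2 * g + 1 ∧
      D.IsDoubleCoverOf C ∧ C.rationalPoints.encard ≤ D.rationalPoints.encard ∧
      ∃ b : k, b ≠ 0 ∧ ∃ z w : D.K, IsHyperellipticModel (2 * g + 1)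
        (f.comp (Polynomial.C 0 + Polynomial.C b * X ^ 2)) z w := by
  obtain ⟨n, hn⟩ := quadraticChar_exists_neg_one (ringChar_ne_two h.two_ne)
  have hn0 : n ≠ 0 := by rintro rfl; simp at hn
  have hsum := pointCount_twist_add h.two_ne hdeg (n := 2 * (2 * g + 1) + 2) (by omega) hn
  obtain ⟨b, hb, hle⟩ : ∃ b : k, b ≠ 0 ∧ pointCount f (2 * g + 2) ≤
      pointCount (f.comp (Polynomial.C 0 + Polynomial.C b * X ^ 2)) (2 * (2 * g + 1) + 2) := by
    by_contra! hcon
    have h1 := hcon 1 one_ne_zero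
    have h2 := hcon n hn0
    omega
  obtain ⟨D, hD, z, w, hm⟩ := exists_doubleCover h (g' := 2 * g + 1) hdeg hb h0
  exact ⟨D, isHyperelliptic_of_model hm (by omega), genus_eq hm, hD,
    encard_rationalPoints_le h hm hle, b, hb, z, w, hm⟩

end SmoothProjCurve

theorem lemma4p4 {k : Type u} [Field k] [Finite k] (q : ℕ) (hq : Nat.card k = q) (hodd : Odd q)
    (C : SmoothProjCurve.{u, v} k) (hC : C.IsHyperelliptic) (g : ℕ) (hg : C.genus = g) :
    (C.rationalWeierstrassPoints.encard = 2 →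
      ∃ D : SmoothProjCurve.{u, v} k, D.IsHyperelliptic ∧ D.genus = 2 * g ∧
        D.IsDoubleCoverOf C ∧ D.rationalWeierstrassPoints.encard = 2 ∧
        C.rationalPoints.encard ≤ D.rationalPoints.encard) ∧
    (C.rationalWeierstrassPoints.encard < (q : ℕ∞) →
      ∃ D : SmoothProjCurve.{u, v} k, D.IsHyperelliptic ∧ D.genus = 2 * g + 1 ∧
        D.IsDoubleCoverOf C ∧
        C.rationalPoints.encard ≤ D.rationalPoints.encard) ∧
    (C.rationalWeierstrassPoints.encard = 2 →
      ∃ D : SmoothProjCurve.{u, v} k, D.IsHyperelliptic ∧ D.genus = 2 * g + 1 ∧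
        D.IsDoubleCoverOf C ∧ D.rationalWeierstrassPoints.encard = 2 ∧
        C.rationalPoints.encard ≤ D.rationalPoints.encard) := by
  classical
  have := Fintype.ofFinite k
  subst hq
  have h2 := two_ne_zero_of_odd_card hodd
  obtain ⟨hg2, x, hx⟩ := hC
  obtain ⟨g', f, y, hm⟩ := hx.exists_model h2
  rw [hg] at hg2
  obtain rfl : g' = g := by rw [← hg, SmoothProjCurve.genus_eq hm]
  rw [Nat.card_eq_fintype_card]
  refine ⟨fun hW => ?_, fun hW => ?_, fun hW => ?_⟩
  · obtain ⟨F, z, w, hF, hdeg, h0⟩ := SmoothProjCurve.exists_model_odd hm hg2 hW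
    obtain ⟨a, ha, hle⟩ := exists_pointCount_le h2 hdeg (n := 2 * (2 * g') + 2) (by omega) h0
    have hna : -a ≠ 0 := neg_ne_zero.2 ha
    obtain ⟨D, hD, s, t, hmD⟩ := SmoothProjCurve.exists_doubleCover hF (g' := 2 * g') hdeg hna
      (mt (h0 a).1 ha)
    refine ⟨D, SmoothProjCurve.isHyperelliptic_of_model hmD (by omega),
      SmoothProjCurve.genus_eq hmD, hD,
      SmoothProjCurve.encard_weierstrass_comp hna (by omega) hdeg hmD ?_,
      SmoothProjCurve.encard_rationalPoints_le hF hmD hle⟩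
    have : Finset.univ.filter (fun x : k => F.eval x = 0) = {0} := by
      ext b; simp [h0]
    -- Since b = −a, the fibre over the only root 0 has 1 + χ(−a)² = 2 points.
    rw [this, Finset.sum_singleton, zero_sub, quadraticChar_sq hna]
    norm_num
  · obtain ⟨F, z, w, hF, hdeg, h0⟩ := SmoothProjCurve.exists_model_even hm hg2 hW
    obtain ⟨D, h1, h3, h4, h5, -⟩ := SmoothProjCurve.exists_doubleCover_even hg2 hF hdeg h0
    exact ⟨D, h1, h3, h4, h5⟩
  · obtain ⟨F, z, w, hF, hdeg, h0⟩ := SmoothProjCurve.exists_model_odd hm hg2 hW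
    obtain ⟨n, hn⟩ := quadraticChar_exists_neg_one (ringChar_ne_two h2)
    have hn0 : n ≠ 0 := by rintro rfl; simp at hn
    have hn1 : n ≠ 1 := by rintro rfl; simp at hn
    obtain ⟨G, z, w, hG, hdegG, s, hs, hroot⟩ := hF.exists_of_ratio hdeg h0 hn1
    have hG0 : G.eval 0 ≠ 0 := by
      rw [Ne, hroot]
      rintro (e | e)
      · exact hs e.symm
      · exact mul_ne_zero hn0 hs e.symm
    obtain ⟨D, h1, h3, h4, h5, b, hb, _, _, hmD⟩ :=
      SmoothProjCurve.exists_doubleCover_even hg2 hG hdegG hG0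
    refine ⟨D, h1, h3, h4,
      SmoothProjCurve.encard_weierstrass_comp hb (by omega) hdegG hmD ?_, h5⟩
    have hne : s ≠ n * s := fun e => hn1 (mul_right_cancel₀ hs (by rw [one_mul]; exact e.symm))
    have : Finset.univ.filter (fun x : k => G.eval x = 0) = {s, n * s} := by
      ext b; simp [hroot]
    -- As χ(n) = −1, the terms χ(b)χ(s) and χ(b)χ(ns) cancel, whichever twist b was chosen.
    rw [this, Finset.sum_pair hne, sub_zero, sub_zero, map_mul (quadraticChar k) n s, hn]
    ring
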